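/- **Attractor tree formula (general version).** Let $S=\mathbb N^r\setminus\{0\}$, and let $\mathcal R=\bigoplus_{\gamma\in\mathbb N^r}\mathcal R_\gamma$ be a graded associative unital $\mathbb Q$-algebra. Let $\langle-,-\rangle$ be an integer-valued skew-symmetric bilinear form on $\mathbb Z^r$ such that, for $\gamma,\gamma'\in S$, $\langle\gamma,\gamma'\rangle=0$ implies $[\mathcal R_\gamma,\mathcal R_{\gamma'}]=0$. Fix $A:S\to\mathcal R$ with $A(\gamma)\in\mathcal R_\gamma$ for all $\gamma\in S$. *Action.* For a function $F:\bigsqcup_{n\ge1}S^n\to\mathbb Q$ (a collection) and $H:S\to\mathcal R$, put $(F*H)(\gamma)=\sum_{n\ge1}\sum_{\alpha\in S^n,\ \alpha_1+\dots+\alpha_n=\gamma}F(\alpha)\,H(\alpha_1)\cdots H(\alpha_n)$, which is a finite sum. *DT invariants.* A central charge is $Z=-\theta+\mathbf i\rho$ with $\theta,\rho\in\mathbb R^r$ and $\rho_k>0$ for all $k$. Its slope is $\mu_Z(a)=\frac{\sum_k\theta_ka_k}{\sum_k\rho_ka_k}$ for $a\in S$. Write $a<_Zb$ if $\mu_Z(a)<\mu_Z(b)$,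 and $a\sim_Zb$ if $\mu_Z(a)=\mu_Z(b)$. Define $A_Z:S\to\mathcal R$ recursively by $$A(\gamma)=\sum_{\alpha_1+\dots+\alpha_n=\gamma,\ \alpha_1>_Z\dots>_Z\alpha_n}A_Z(\alpha_1)\cdots A_Z(\alpha_n),\qquad\gamma\in S.$$ The rational DT invariants are $\bar A_Z=\mathbf{log}_Z*A_Z$, where, for $\alpha\in S^n$, $\mathbf{log}_Z(\alpha)=\frac{(-1)^{n-1}}n$ if $\alpha_1\sim_Z\dots\sim_Z\alpha_n$, and $\mathbf{log}_Z(\alpha)=0$ otherwise. For $\theta\in\mathbb R^r$, the index $\theta$ (as in $\bar A_\theta$ or $\sim_\theta$) refers to the central charge with this $\theta$ and $\rho=(1,\dots,1)$. Call $\theta$ generic if, for $a,b\in S$, $a\sim_\theta b$ implies $ma=nb$ for some integers $m,n\ge1$. *Attractor invariants.* For $\gamma\in S$, $\bar A_*(\gamma)=\bar A_{\theta'}(\gamma)$, where $\theta'$ is a generic perturbation of $\theta=\langle-,\gamma\rangle$, that is, any generic element of a sufficiently small neighbourhood (depending on $\gamma$) of the vector in $\mathbb R^r$ with coordinates $\theta_k=\langle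 e_k,\gamma\rangle$. *Tree collections.* Let $t\in\mathbb Q$. For $\alpha\in S^n$ and $1\le k<n$ let $\alpha_{\le k}=\alpha_1+\dots+\alpha_k$ and $\alpha_{>k}=\alpha_{k+1}+\dots+\alpha_n$. Put $$g_{Z,t}(\alpha)=t^{n_-}(t-1)^{n_+}\,\frac{t^{n_0+1}-(t-1)^{n_0+1}}{n_0+1},$$ where $n_+,n_-,n_0$ are the numbers of $1\le k<n$ with $\alpha_{\le k}>_Z\alpha_{>k}$, $\alpha_{\le k}<_Z\alpha_{>k}$, $\alpha_{\le k}\sim_Z\alpha_{>k}$ respectively (with $0^0=1$). Define $g_{*,t}(\alpha)$ by the same expression, where now $n_+,n_-,n_0$ are the numbers of $1\le k<n$ with $\langle\alpha_{\le k},\alpha_{>k}\rangle$ positive, negative, zero respectively. Put $F_{Z,t}(\alpha)=1$ for $\alpha\in S^1$, and, for $\alpha\in S^n$ with $n\ge2$, $$F_{Z,t}(\alpha)=\sum_T(-1)^{|V(T)|-1}\bigl(g_{Z,t}(\alpha|_{\mathrm{ch}\,v_0})-g_{*,t}(\alpha|_{\mathrm{ch}\,v_0})\bigr)\prod_{v\in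 V(T)\setminus\{v_0\}}g_{*,t}(\alpha|_{\mathrm{ch}\,v}).$$ The sum runs over plane rooted trees $T$ with leaves $1,\dots,n$ (in this order) all of whose internal vertices have at least two children. Here $V(T)$ is the set of internal vertices, $v_0$ is the root, and $\alpha|_{\mathrm{ch}\,v}=(\alpha_u)_u$ is the tuple indexed by the children $u$ of $v$ in their order, with $\alpha_u$ the sum of the $\alpha_i$ over the leaves $i$ below or equal to $u$. **Theorem.** The attractor invariants $\bar A_*(\gamma)$ are well defined, i.e. for every $\gamma\in S$ the value $\bar A_{\theta'}(\gamma)$ is the same for all generic $\theta'$ sufficiently close to $\langle-,\gamma\rangle$. For every central charge $Z$ and every $t\in\mathbb Q$, $\bar A_Z=F_{Z,t}*\bar A_*$, i.e. for every $\gamma\in S$ $$\bar A_Z(\gamma)=\sum_{n\ge1}\ \sum_{\alpha\in S^n,\ \alpha_1+\dots+\alpha_n=\gamma}F_{Z,t}(\alpha)\,\bar A_*(\alpha_1)\cdots\bar A_*(\alpha_n).$$ -/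

import Mathlib

open Filter Topology

/-- Vectors in `ℕ^r`. The semigroup `S = ℕ^r \ {0}` is the set of nonzero ones. -/
abbrev DimVec (r : ℕ) : Type := Fin r → ℕ

/-- The inclusion `ℕ^r ⊆ Γ = ℤ^r`. -/
def DimVec.toInt {r : ℕ} (a : DimVec r) : Fin r → ℤ := fun k => (a k : ℤ)

/-- Collections with values in `ℚ`: functions of a tuple `α = (α₁, …, αₙ)`. Only their values at
nonempty tuples of nonzero vectors are ever used. -/
abbrev Coll (r : ℕ) : Type := List (DimVec r) → ℚ

/-! ### Tuples with a given sum, and the action of collections on 1-collections -/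

theorem finite_lists_of_mem {X : Type*} {s : Set X} (hs : s.Finite) (n : ℕ) :
    {l : List X | l.length ≤ n ∧ ∀ x ∈ l, x ∈ s}.Finite := by
  have : Finite s := hs
  refine ((List.finite_length_le s n).image (List.map Subtype.val)).subset ?_
  rintro l ⟨h1, h2⟩
  lift l to List s using h2
  exact ⟨l, by simpa using h1, rfl⟩

theorem DimVec.length_le_of_sum_eq {r : ℕ} :
    ∀ α : List (DimVec r), (0 : DimVec r) ∉ α → α.length ≤ ∑ i, α.sum i
  | [], _ => by simp
  | a :: α, h => by
    have h1 := DimVec.length_le_of_sum_eq α (fun h' => h (List.mem_cons_of_mem _ h'))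
    have ha : a ≠ 0 := fun h' => h (by simp [h'])
    obtain ⟨i, hi⟩ := Function.ne_iff.1 ha
    have h2 : a i ≤ ∑ i, a i := Finset.single_le_sum (fun _ _ => Nat.zero_le _) (Finset.mem_univ i)
    simp only [List.length_cons, List.sum_cons, Pi.add_apply, Finset.sum_add_distrib]
    simp only [Pi.zero_apply] at hi
    omega

theorem DimVec.finite_tuples {r : ℕ} (γ : DimVec r) :
    {α : List (DimVec r) | (0 : DimVec r) ∉ α ∧ α.sum = γ}.Finite := by
  refine (finite_lists_of_mem (Set.finite_Iic γ) (∑ i, γ i)).subset ?_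
  rintro α ⟨h0, rfl⟩
  exact ⟨DimVec.length_le_of_sum_eq α h0, fun x hx => List.le_sum_of_mem hx⟩

/-- All tuples `α` of elements of `S`, of any length, with `α₁ + ⋯ + αₙ = γ`. -/
noncomputable def tuples {r : ℕ} (γ : DimVec r) : Finset (List (DimVec r)) :=
  (DimVec.finite_tuples γ).toFinset

theorem mem_tuples {r : ℕ} {γ : DimVec r} {α : List (DimVec r)} :
    α ∈ tuples γ ↔ (0 : DimVec r) ∉ α ∧ α.sum = γ := by
  simp [tuples]

/-- The action of a collection on a 1-collection,
`(F * H)(γ) = ∑_{α₁ + ⋯ + αₙ = γ} F(α) H(α₁) ⋯ H(αₙ)`. -/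
noncomputable def Coll.act {r : ℕ} {R : Type*} [Ring R] [Algebra ℚ R]
    (F : Coll r) (H : DimVec r → R) (γ : DimVec r) : R :=
  ∑ α ∈ tuples γ, F α • (α.map H).prod

/-! ### Central charges -/

/-- A central charge `Z = -θ + iρ` on `ℤ^r`, with `ρ_k > 0` for all `k`. -/
structure CentralCharge (r : ℕ) where
  θ : Fin r → ℝ
  ρ : Fin r → ℝ
  ρ_pos : ∀ k, 0 < ρ k

namespace CentralCharge

variable {r : ℕ}

/-- The central charge with the given `θ` and with `ρ = (1, …, 1)`. -/
def ofTheta (θ : Fin r → ℝ) : CentralCharge r := ⟨θ, fun _ => 1, fun _ => one_pos⟩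

/-- The complex number `Z(a)`. -/
noncomputable def value (Z : CentralCharge r) (a : DimVec r) : ℂ :=
  -((∑ k, Z.θ k * a k : ℝ) : ℂ) + Complex.I * ((∑ k, Z.ρ k * a k : ℝ) : ℂ)

/-- The slope `μ_Z(a) = θ(a) / ρ(a)`. -/
noncomputable def slope (Z : CentralCharge r) (a : DimVec r) : ℝ :=
  (∑ k, Z.θ k * a k) / (∑ k, Z.ρ k * a k)

/-- `a <_Z b`. -/
def Lt (Z : CentralCharge r) (a b : DimVec r) : Prop := Z.slope a < Z.slope b

/-- `a ∼_Z b`. -/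
def Equiv (Z : CentralCharge r) (a b : DimVec r) : Prop := Z.slope a = Z.slope b

theorem rho_pos (Z : CentralCharge r) {a : DimVec r} (ha : a ≠ 0) : 0 < ∑ k, Z.ρ k * a k := by
  obtain ⟨i, hi⟩ := Function.ne_iff.1 ha
  refine Finset.sum_pos' (fun k _ => mul_nonneg (Z.ρ_pos k).le (Nat.cast_nonneg _))
    ⟨i, Finset.mem_univ i, mul_pos (Z.ρ_pos i) ?_⟩
  exact_mod_cast Nat.pos_of_ne_zero hi

/-- Comparing slopes is the same as comparing the arguments of the complex numbers `Z(a)`. -/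
theorem arg_lt_arg_iff (Z : CentralCharge r) {a b : DimVec r} (ha : a ≠ 0) (hb : b ≠ 0) :
    (Z.value a).arg < (Z.value b).arg ↔ Z.Lt a b := by
  have key : ∀ x y : ℝ, 0 < y →
      (-(x : ℂ) + Complex.I * (y : ℂ)).arg = Real.pi / 2 + Real.arctan (x / y) := by
    intro x y hy
    have hc := Real.cos_arctan_pos (x / y)
    have h : (-(x : ℂ) + Complex.I * (y : ℂ)) =
        ((y / Real.cos (Real.arctan (x / y)) : ℝ) : ℂ) *
          (Complex.cos ((Real.pi / 2 + Real.arctan (x / y) : ℝ) : ℂ) +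
            Complex.sin ((Real.pi / 2 + Real.arctan (x / y) : ℝ) : ℂ) * Complex.I) := by
      have h1 : Real.cos (Real.pi / 2 + Real.arctan (x / y)) = -Real.sin (Real.arctan (x / y)) := by
        rw [add_comm, Real.cos_add_pi_div_two]
      have h2 : Real.sin (Real.pi / 2 + Real.arctan (x / y)) = Real.cos (Real.arctan (x / y)) := by
        rw [add_comm, Real.sin_add_pi_div_two]
      have h3 : y * Real.sin (Real.arctan (x / y)) / Real.cos (Real.arctan (x / y)) = x := by
        rw [mul_div_assoc, ← Real.tan_eq_sin_div_cos, Real.tan_arctan, mul_div_cancel₀ _ hy.ne']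
      rw [← Complex.ofReal_cos, ← Complex.ofReal_sin, h1, h2]
      apply Complex.ext
      · simp [-Complex.ofReal_cos, -Complex.ofReal_sin, -Complex.ofReal_div]
        linarith [h3, div_mul_eq_mul_div y (Real.cos (Real.arctan (x / y)))
          (Real.sin (Real.arctan (x / y)))]
      · simp [-Complex.ofReal_cos, -Complex.ofReal_sin, -Complex.ofReal_div]
        field_simp
    rw [h]
    refine Complex.arg_mul_cos_add_sin_mul_I (div_pos hy hc) ⟨?_, ?_⟩
    · linarith [Real.neg_pi_div_two_lt_arctan (x / y), Real.pi_pos]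
    · linarith [Real.arctan_lt_pi_div_two (x / y)]
  unfold value Lt slope
  rw [key _ _ (Z.rho_pos ha), key _ _ (Z.rho_pos hb)]
  rw [add_lt_add_iff_left, Real.arctan_strictMono.lt_iff_lt]

end CentralCharge

/-! ### Donaldson-Thomas invariants -/

section Invariants

variable {r : ℕ}

open Classical in
/-- The Harder-Narasimhan collection `s_Z`: equal to `1` if `α₁ >_Z ⋯ >_Z αₙ`, and to `0`
otherwise. -/
noncomputable def hnColl (Z : CentralCharge r) : Coll r := fun α =>
  if α.Pairwise (fun a b => Z.Lt b a) then 1 else 0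

open Classical in
/-- The logarithmic collection `log_Z`: equal to `(-1)^(n-1) / n` if `α₁ ∼_Z ⋯ ∼_Z αₙ`, and to `0`
otherwise. -/
noncomputable def logColl (Z : CentralCharge r) : Coll r := fun α =>
  if α.Pairwise Z.Equiv then (-1) ^ (α.length - 1) / (α.length : ℚ) else 0

theorem sum_lt_of_mem_tuples {γ a : DimVec r} {α : List (DimVec r)} (hα : α ∈ tuples γ)
    (hl : 2 ≤ α.length) (ha : a ∈ α) : ∑ i, a i < ∑ i, γ i := by
  obtain ⟨h0, rfl⟩ := mem_tuples.1 hα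
  have hs : a + (α.erase a).sum = α.sum := by
    rw [← List.sum_cons, (List.perm_cons_erase ha).sum_eq]
  have h1 := DimVec.length_le_of_sum_eq (α.erase a) (fun h => h0 (List.mem_of_mem_erase h))
  rw [List.length_erase_of_mem ha] at h1
  rw [← hs]
  simp only [Pi.add_apply, Finset.sum_add_distrib]
  omega

theorem tuples_filter_short {γ : DimVec r} (hγ : γ ≠ 0) :
    (tuples γ).filter (fun α => ¬ 2 ≤ α.length) = {[γ]} := by
  ext α
  simp only [Finset.mem_filter, mem_tuples, Finset.mem_singleton]
  constructor
  · rintro ⟨⟨h0, hs⟩, hl⟩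
    match α, h0, hs, hl with
    | [], _, hs, _ => exact absurd hs.symm hγ
    | [a], _, hs, _ => simpa using hs
    | a :: b :: l, _, _, hl => simp at hl
  · rintro rfl
    simp [hγ.symm]

variable {R : Type*} [Ring R] [Algebra ℚ R]

/-- The stacky invariants `A_Z`, defined recursively by the basic wall-crossing formula
`A(γ) = ∑_{α₁ + ⋯ + αₙ = γ, α₁ >_Z ⋯ >_Z αₙ} A_Z(α₁) ⋯ A_Z(αₙ)`, in which the summand with `n = 1`
is `A_Z(γ)`; see `hnColl_act_stackyDT`. -/
noncomputable def stackyDT (Z : CentralCharge r) (A : DimVec r → R) (γ : DimVec r) : R :=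
  A γ - ∑ α ∈ ((tuples γ).filter (fun α => 2 ≤ α.length)).attach,
    hnColl Z α.1 • (α.1.attach.map (fun a => stackyDT Z A a.1)).prod
termination_by ∑ i, γ i
decreasing_by
  have h := Finset.mem_filter.1 α.2
  exact sum_lt_of_mem_tuples h.1 h.2 a.2

theorem stackyDT_eq (Z : CentralCharge r) (A : DimVec r → R) (γ : DimVec r) :
    stackyDT Z A γ = A γ - ∑ α ∈ (tuples γ).filter (fun α => 2 ≤ α.length),
      hnColl Z α • (α.map (stackyDT Z A)).prod := by
  rw [stackyDT, ← Finset.sum_attach ((tuples γ).filter (fun α => 2 ≤ α.length))]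
  congr 1
  refine Finset.sum_congr rfl fun α _ => ?_
  rw [List.map_attach_eq_pmap, List.pmap_eq_map]

/-- The basic wall-crossing formula `A = s_Z * A_Z`. -/
theorem hnColl_act_stackyDT (Z : CentralCharge r) (A : DimVec r → R) {γ : DimVec r} (hγ : γ ≠ 0) :
    (hnColl Z).act (stackyDT Z A) γ = A γ := by
  have h1 := tuples_filter_short hγ
  rw [Coll.act, ← Finset.sum_filter_add_sum_filter_not (tuples γ) (fun α => 2 ≤ α.length), h1,
    Finset.sum_singleton]
  have h2 : hnColl Z [γ] = 1 := by simp [hnColl]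
  rw [h2, List.map_singleton, List.prod_singleton, one_smul, stackyDT_eq Z A γ]
  abel

/-- The basic wall-crossing formula determines `A_Z`. -/
theorem stackyDT_unique (Z : CentralCharge r) (A B : DimVec r → R)
    (hB : ∀ γ : DimVec r, γ ≠ 0 → (hnColl Z).act B γ = A γ) (γ : DimVec r) (hγ : γ ≠ 0) :
    B γ = stackyDT Z A γ := by
  have h := (hB γ hγ).trans (hnColl_act_stackyDT Z A hγ).symm
  have h1 : (tuples γ).filter (fun α => ¬ 2 ≤ α.length) = {[γ]} := tuples_filter_short hγ
  rw [Coll.act, Coll.act, ← Finset.sum_filter_add_sum_filter_not (tuples γ) (fun α => 2 ≤ α.length),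
    ← Finset.sum_filter_add_sum_filter_not (tuples γ) (fun α => 2 ≤ α.length)
      (fun α => hnColl Z α • (α.map (stackyDT Z A)).prod), h1,
    Finset.sum_singleton, Finset.sum_singleton] at h
  have h2 : ∑ α ∈ (tuples γ).filter (fun α => 2 ≤ α.length), hnColl Z α • (α.map B).prod =
      ∑ α ∈ (tuples γ).filter (fun α => 2 ≤ α.length),
        hnColl Z α • (α.map (stackyDT Z A)).prod := by
    refine Finset.sum_congr rfl fun α hα => ?_
    have hα' := Finset.mem_filter.1 hα
    congr 2
    refine List.map_congr_left fun a ha => ?_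
    have hlt := sum_lt_of_mem_tuples hα'.1 hα'.2 ha
    exact stackyDT_unique Z A B hB a fun h0 => (mem_tuples.1 hα'.1).1 (h0 ▸ ha)
  have h3 : hnColl Z [γ] = 1 := by simp [hnColl]
  rw [h2, add_right_inj, h3] at h
  simpa using h
termination_by ∑ i, γ i

/-- The rational invariants `Ā_Z = log_Z * A_Z`. -/
noncomputable def rationalDT (Z : CentralCharge r) (A : DimVec r → R) : DimVec r → R :=
  (logColl Z).act (stackyDT Z A)

/-! ### Attractor invariants -/

/-- The stability parameter `θ` is generic: `a ∼_θ b` only if `a` and `b` are proportional. -/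
def IsGeneric (θ : Fin r → ℝ) : Prop :=
  ∀ a b : DimVec r, a ≠ 0 → b ≠ 0 → (CentralCharge.ofTheta θ).Equiv a b →
    ∃ m n : ℕ, 1 ≤ m ∧ 1 ≤ n ∧ m • a = n • b

/-- The self-stability `θ = ⟨-, γ⟩`. -/
def selfStability (ω : (Fin r → ℤ) →ₗ[ℤ] (Fin r → ℤ) →ₗ[ℤ] ℤ) (γ : DimVec r) : Fin r → ℝ :=
  fun k => (ω (Pi.single k 1) γ.toInt : ℝ)

/-- The filter of generic perturbations of `⟨-, γ⟩`: a property holds eventually along it if it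
holds for all generic parameters in some neighbourhood of `⟨-, γ⟩`. -/
def genericPerturbations (ω : (Fin r → ℤ) →ₗ[ℤ] (Fin r → ℤ) →ₗ[ℤ] ℤ) (γ : DimVec r) :
    Filter (Fin r → ℝ) :=
  𝓝[{θ | IsGeneric θ}] (selfStability ω γ)

/-- The attractor invariant `Ā_*(γ)`: the common value of `Ā_θ'(γ)` for all generic `θ'` close
enough to `⟨-, γ⟩`. -/
noncomputable def attractorDT (ω : (Fin r → ℤ) →ₗ[ℤ] (Fin r → ℤ) →ₗ[ℤ] ℤ) (A : DimVec r → R)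
    (γ : DimVec r) : R :=
  Classical.epsilon fun x : R =>
    ∀ᶠ θ' in genericPerturbations ω γ, rationalDT (CentralCharge.ofTheta θ') A γ = x

end Invariants

/-! ### Plane trees -/

/-- Plane rooted trees with leaves labelled by elements of `X`. -/
inductive PlaneTree (X : Type*) : Type _
  | leaf (x : X) : PlaneTree X
  | node (children : List (PlaneTree X)) : PlaneTree X

namespace PlaneTree

variable {X : Type*}

/-- The labels of the leaves, from left to right. -/
def leaves : PlaneTree X → List X
  | leaf x => [x]
  | node c => c.flatMap leaves

/-- The internal vertices, each recorded through its list of children, the root coming first. -/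
def vertices : PlaneTree X → List (List (PlaneTree X))
  | leaf _ => []
  | node c => c :: c.flatMap vertices

/-- All internal vertices have at least two children. -/
def IsReduced (T : PlaneTree X) : Prop := ∀ c ∈ T.vertices, 2 ≤ c.length

theorem leaves_ne_nil : ∀ T : PlaneTree X, T.IsReduced → T.leaves ≠ []
  | leaf x, _ => by simp [leaves]
  | node [], h => absurd (h [] (by simp [vertices])) (by simp)
  | node (u :: c), h => by
    have hu := leaves_ne_nil u fun d hd => h d (by simp [vertices, hd])
    simp [leaves, hu]

theorem finite_reduced (n : ℕ) : ∀ s : Set X, s.Finite →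
    {T : PlaneTree X | T.leaves.length ≤ n ∧ (∀ x ∈ T.leaves, x ∈ s) ∧ T.IsReduced}.Finite := by
  induction n with
  | zero =>
    intro s _
    refine Set.finite_empty.subset ?_
    rintro T ⟨h1, -, h3⟩
    exact leaves_ne_nil T h3 (List.length_eq_zero_iff.1 (Nat.le_zero.1 h1))
  | succ n ih =>
    intro s hs
    refine ((hs.image leaf).union ((finite_lists_of_mem (ih s hs) (n + 1)).image node)).subset ?_
    rintro (x | c) ⟨h1, h2, h3⟩
    · exact Or.inl ⟨x, h2 x (by simp [leaves]), rfl⟩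
    · right
      have hred : ∀ u ∈ c, u.IsReduced := fun u hu d hd =>
        h3 d (by simp only [vertices, List.mem_cons, List.mem_flatMap]; exact Or.inr ⟨u, hu, hd⟩)
      have hpos : ∀ u ∈ c, 1 ≤ u.leaves.length := fun u hu =>
        List.length_pos_iff.2 (leaves_ne_nil u (hred u hu))
      have hc : 2 ≤ c.length := h3 c (by simp [vertices])
      have hlen : ∀ l : List (PlaneTree X), (∀ u ∈ l, 1 ≤ u.leaves.length) →
          l.length ≤ (l.flatMap leaves).length := by
        intro l hl
        induction l with
        | nil => simp
        | cons u l ihl =>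
          have h4 := hl u (by simp)
          have h5 := ihl fun v hv => hl v (by simp [hv])
          simp only [List.flatMap_cons, List.length_append, List.length_cons]
          omega
      simp only [leaves] at h1 h2
      refine ⟨c, ⟨(hlen c hpos).trans h1, fun u hu => ⟨?_, ?_, hred u hu⟩⟩, rfl⟩
      · obtain ⟨l₁, l₂, rfl⟩ := List.append_of_mem hu
        have h4 := hlen l₁ fun v hv => hpos v (by simp [hv])
        have h5 := hlen l₂ fun v hv => hpos v (by simp [hv])
        simp only [List.flatMap_append, List.flatMap_cons, List.length_append,
          List.length_cons] at h1 hc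
        omega
      · exact fun x hx => h2 x (List.mem_flatMap.2 ⟨u, hu, hx⟩)

theorem finite_reduced_on (α : List X) :
    {T : PlaneTree X | T.leaves = α ∧ T.IsReduced}.Finite := by
  refine (finite_reduced α.length {x | x ∈ α} (List.finite_toSet α)).subset ?_
  rintro T ⟨rfl, h⟩
  exact ⟨le_rfl, fun x hx => hx, h⟩

/-- The plane rooted trees with leaves `1, …, n`, the leaf `i` carrying the label `αᵢ`, such that
all internal vertices have at least two children. -/
noncomputable def reducedOn (α : List X) : Finset (PlaneTree X) := (finite_reduced_on α).toFinset

theorem mem_reducedOn {α : List X} {T : PlaneTree X} :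
    T ∈ reducedOn α ↔ T.leaves = α ∧ T.IsReduced := by
  simp [reducedOn]

/-- The tuple `α|_{ch v}` attached to the vertex `v` with the list of children `c`: its entry at a
child `u` is the sum of the labels of the leaves below `u`. -/
def childTuple {r : ℕ} (c : List (PlaneTree (DimVec r))) : List (DimVec r) :=
  c.map fun u => u.leaves.sum

/-- The contribution
`(-1)^(|V(T)| - 1) (g(α|_{ch v₀}) - h(α|_{ch v₀})) ∏_{v ∈ V(T) \ {v₀}} h(α|_{ch v})`
of a tree `T` with root `v₀`. -/
def contribution {r : ℕ} (g h : Coll r) : PlaneTree (DimVec r) → ℚ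
  | leaf _ => 0
  | node c =>
    (-1) ^ ((node c).vertices.length - 1) * (g (childTuple c) - h (childTuple c)) *
      ((node c).vertices.tail.map fun c' => h (childTuple c')).prod

end PlaneTree

/-! ### The collections of the attractor tree formula -/

section TreeFormula

variable {r : ℕ}

open Classical in
/-- The number of `1 ≤ k < n` such that `P (α₁ + ⋯ + α_k) (α_{k+1} + ⋯ + αₙ)` holds. -/
noncomputable def cutCount (P : DimVec r → DimVec r → Prop) (α : List (DimVec r)) : ℕ :=
  ((Finset.Ico 1 α.length).filter fun k => P (α.take k).sum (α.drop k).sum).card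

/-- `t^{n₋} (t-1)^{n₊} (t^{n₀+1} - (t-1)^{n₀+1}) / (n₀+1)`. -/
def geometricValue (t : ℚ) (nPos nNeg nZero : ℕ) : ℚ :=
  t ^ nNeg * (t - 1) ^ nPos * ((t ^ (nZero + 1) - (t - 1) ^ (nZero + 1)) / (nZero + 1))

/-- The collection `g_{Z,t}`. -/
noncomputable def gColl (Z : CentralCharge r) (t : ℚ) : Coll r := fun α =>
  geometricValue t (cutCount (fun a b => Z.Lt b a) α) (cutCount (fun a b => Z.Lt a b) α)
    (cutCount (fun a b => Z.Equiv a b) α)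

/-- The collection `g_{*,t}`. -/
noncomputable def gStarColl (ω : (Fin r → ℤ) →ₗ[ℤ] (Fin r → ℤ) →ₗ[ℤ] ℤ) (t : ℚ) : Coll r := fun α =>
  geometricValue t (cutCount (fun a b => 0 < ω a.toInt b.toInt) α)
    (cutCount (fun a b => ω a.toInt b.toInt < 0) α)
    (cutCount (fun a b => ω a.toInt b.toInt = 0) α)

/-- The collection `F_{Z,t}`: equal to `1` at tuples of length one, and to a sum over plane trees
at longer tuples. -/
noncomputable def treeColl (ω : (Fin r → ℤ) →ₗ[ℤ] (Fin r → ℤ) →ₗ[ℤ] ℤ) (Z : CentralCharge r)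
    (t : ℚ) : Coll r := fun α =>
  if α.length = 1 then 1
  else ∑ T ∈ PlaneTree.reducedOn α, T.contribution (gColl Z t) (gStarColl ω t)

end TreeFormula

/-! Everything takes place in power series with coefficients in `R`, in variables that commute with
the coefficients: collections become series, and cutting a tuple becomes multiplication.

Fix `Z` and `γ`. Grouping Harder-Narasimhan tuples by slope relative to `γ` factors `1 + A` as `U (1
+ y) L`, where `y` is the part of `A_Z` of the slope of `γ` (`slope_factorization`), and `Ā_Z(γ)` is
the coefficient of `log (1 + y)` at `γ` (`rationalDT_eq_logCoeff`).

The key point is that one series `a`, independent of `Z`, yields all invariants. It is defined by `1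
+ A = (1 - t a)⁻¹ (1 - (t - 1) a)`, and `Ā_Z = g_{Z,t} * a` (`rationalDT_eq_gColl_act`). To see
this, weight each proper initial sum of a tuple by `t - 1`, `t` or `s + t`, according to whether its
slope is larger than, smaller than or equal to that of `γ`. With these weights the factorization
collapses in the slope of `γ` to `Y = (1 + s Y) y`, so that `Y = ∑ s^k y^(k+1)`
(`pathColl_act_eq_sum`). Integrating over `s` from `-1` to `0` turns the right side into `log (1 +
y)` and the powers of `s + t` into the last factor of `g_{Z,t}`.

For the self-stability of `γ`, degrees of the slope of `γ` are orthogonal to `γ`, so two such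
degrees with sum `γ` are orthogonal to each other. Hence the coefficient at `γ` is a trace on the
relevant series, the logarithm is additive under it (`logCoeff_mul`), and a small change of
stability does not alter the invariant at `γ` (`rationalDT_eq_of_close`). So `Ā_*(γ)` is well
defined and equals the invariant at the self-stability itself, where `g_{Z,t}` agrees with `g_{*,t}`
on tuples of sum `γ`. Therefore `Ā_* = g_{*,t} * a` (`attractorDT_eq_gStarColl_act`).

It remains to eliminate `a`. A collection equal to `1` on tuples of length one is inverted by a
signed sum over reduced plane trees (`act_inverseAct_self`), and substituting this inverse into
`g_{Z,t} * a` produces the tree sum `F_{Z,t}` (`treeColl_act`). -/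

set_option linter.unusedSectionVars false

/-! ### Power series indexed by dimension vectors -/

section Series

variable {r : ℕ}

/-- The pairs of dimension vectors with a given sum. -/
def DimVec.splittings (a : DimVec r) : Finset (DimVec r × DimVec r) :=
  (Finset.Icc 0 a ×ˢ Finset.Icc 0 a).filter fun p => p.1 + p.2 = a

theorem DimVec.mem_splittings {a : DimVec r} {p : DimVec r × DimVec r} :
    p ∈ a.splittings ↔ p.1 + p.2 = a := by
  simp only [splittings, Finset.mem_filter, Finset.mem_product, Finset.mem_Icc, zero_le, true_and,
    and_iff_right_iff_imp]
  rintro rfl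
  exact ⟨le_self_add, le_add_self⟩

/-- The total degree of a dimension vector. -/
def DimVec.deg (a : DimVec r) : ℕ := ∑ i, a i

theorem DimVec.deg_add (a b : DimVec r) : (a + b).deg = a.deg + b.deg := by
  simp [deg, Finset.sum_add_distrib]

theorem DimVec.deg_eq_zero {a : DimVec r} : a.deg = 0 ↔ a = 0 := by
  simp [deg, funext_iff]

theorem DimVec.deg_lt_of_lt {a b : DimVec r} (h : a < b) : a.deg < b.deg := by
  obtain ⟨c, rfl⟩ := exists_add_of_le h.le
  have hc : c ≠ 0 := by rintro rfl; simp at h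
  have := mt DimVec.deg_eq_zero.1 hc
  rw [deg_add]
  omega

variable {R : Type*} [Ring R]

/-- The coefficient of a power series at a dimension vector. -/
noncomputable def coeffAt (f : MvPowerSeries (Fin r) R) (a : DimVec r) : R :=
  MvPowerSeries.coeff (Finsupp.equivFunOnFinite.symm a) f

/-- The power series with given coefficients. -/
def seriesOf (H : DimVec r → R) : MvPowerSeries (Fin r) R := fun n => H n

@[simp] theorem coeffAt_seriesOf (H : DimVec r → R) (a : DimVec r) :
    coeffAt (seriesOf H) a = H a := rfl

theorem series_ext {f g : MvPowerSeries (Fin r) R} (h : ∀ a, coeffAt f a = coeffAt g a) :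
    f = g := by
  refine MvPowerSeries.ext fun n => ?_
  have := h n
  rwa [coeffAt, coeffAt, Finsupp.equivFunOnFinite_symm_coe] at this

@[simp] theorem coeffAt_add (f g : MvPowerSeries (Fin r) R) (a : DimVec r) :
    coeffAt (f + g) a = coeffAt f a + coeffAt g a := map_add _ _ _

@[simp] theorem coeffAt_sub (f g : MvPowerSeries (Fin r) R) (a : DimVec r) :
    coeffAt (f - g) a = coeffAt f a - coeffAt g a := map_sub _ _ _

@[simp] theorem coeffAt_neg (f : MvPowerSeries (Fin r) R) (a : DimVec r) :
    coeffAt (-f) a = -coeffAt f a := map_neg _ _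

@[simp] theorem coeffAt_zero (a : DimVec r) :
    coeffAt (0 : MvPowerSeries (Fin r) R) a = 0 := rfl

theorem coeffAt_sum {ι : Type*} (s : Finset ι) (f : ι → MvPowerSeries (Fin r) R) (a : DimVec r) :
    coeffAt (∑ i ∈ s, f i) a = ∑ i ∈ s, coeffAt (f i) a := map_sum _ _ _

theorem coeffAt_one (a : DimVec r) :
    coeffAt (1 : MvPowerSeries (Fin r) R) a = if a = 0 then 1 else 0 := by
  classical
  rw [coeffAt, MvPowerSeries.coeff_one]
  congr 1
  simp [Finsupp.ext_iff, funext_iff]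

@[simp] theorem coeffAt_one_zero : coeffAt (1 : MvPowerSeries (Fin r) R) 0 = 1 := by
  simp [coeffAt_one]

theorem coeffAt_mul (f g : MvPowerSeries (Fin r) R) (a : DimVec r) :
    coeffAt (f * g) a = ∑ p ∈ a.splittings, coeffAt f p.1 * coeffAt g p.2 := by
  classical
  rw [coeffAt, MvPowerSeries.coeff_mul]
  refine Finset.sum_nbij' (fun p => (⇑p.1, ⇑p.2))
    (fun p => (Finsupp.equivFunOnFinite.symm p.1, Finsupp.equivFunOnFinite.symm p.2))
    ?_ ?_ ?_ ?_ ?_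
  · intro p hp
    rw [Finset.HasAntidiagonal.mem_antidiagonal] at hp
    rw [DimVec.mem_splittings]
    simpa using congrArg (fun x : Fin r →₀ ℕ => (x : Fin r → ℕ)) hp
  · intro p hp
    rw [DimVec.mem_splittings] at hp
    rw [Finset.HasAntidiagonal.mem_antidiagonal]
    ext i
    simpa using congrFun hp i
  · intro p _
    ext <;> simp
  · intro p _
    ext <;> simp
  · intro p _
    simp only [coeffAt]
    congr 2 <;> ext <;> simp

theorem coeffAt_mul_zero (f g : MvPowerSeries (Fin r) R) :
    coeffAt (f * g) 0 = coeffAt f 0 * coeffAt g 0 := by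
  have : (0 : DimVec r).splittings = {(0, 0)} := by
    ext p
    rw [DimVec.mem_splittings, add_eq_zero]
    simp [Prod.ext_iff]
  rw [coeffAt_mul, this, Finset.sum_singleton]

theorem coeffAt_zero_eq_constantCoeff (f : MvPowerSeries (Fin r) R) :
    coeffAt f 0 = MvPowerSeries.constantCoeff f := by
  rw [coeffAt, ← MvPowerSeries.coeff_zero_eq_constantCoeff_apply]
  congr 2
  ext; simp

theorem exists_inverse {f : MvPowerSeries (Fin r) R} (hf : coeffAt f 0 = 1) :
    ∃ g, f * g = 1 ∧ g * f = 1 ∧ coeffAt g 0 = 1 := by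
  rw [coeffAt_zero_eq_constantCoeff] at hf
  refine ⟨MvPowerSeries.invOfUnit f 1, MvPowerSeries.mul_invOfUnit f 1 (by simpa using hf),
    MvPowerSeries.invOfUnit_mul f 1 (by simpa using hf), ?_⟩
  simp [coeffAt_zero_eq_constantCoeff]

variable [Algebra ℚ R]

@[simp] theorem coeffAt_smul (q : ℚ) (f : MvPowerSeries (Fin r) R) (a : DimVec r) :
    coeffAt (q • f) a = q • coeffAt f a := rfl

/-! ### Series with coefficients in a graded family -/

/-- A family of subspaces of `R` that is closed under multiplication. -/
structure IsGradedFamily (C : DimVec r → Submodule ℚ R) : Prop where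
  one_mem : 1 ∈ C 0
  mul_mem : ∀ a b x y, x ∈ C a → y ∈ C b → x * y ∈ C (a + b)

/-- The coefficients of `f` lie in the family `C`. -/
def CoeffsIn (C : DimVec r → Submodule ℚ R) (f : MvPowerSeries (Fin r) R) : Prop :=
  ∀ a, coeffAt f a ∈ C a

section CoeffsIn

variable {C : DimVec r → Submodule ℚ R}

theorem CoeffsIn.add {f g : MvPowerSeries (Fin r) R} (hf : CoeffsIn C f) (hg : CoeffsIn C g) :
    CoeffsIn C (f + g) := fun a => by
  rw [coeffAt_add]; exact (C a).add_mem (hf a) (hg a)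

theorem CoeffsIn.sub {f g : MvPowerSeries (Fin r) R} (hf : CoeffsIn C f) (hg : CoeffsIn C g) :
    CoeffsIn C (f - g) := fun a => by
  rw [coeffAt_sub]; exact (C a).sub_mem (hf a) (hg a)

theorem CoeffsIn.mul (hC : IsGradedFamily C) {f g : MvPowerSeries (Fin r) R} (hf : CoeffsIn C f)
    (hg : CoeffsIn C g) : CoeffsIn C (f * g) := fun a => by
  rw [coeffAt_mul]
  refine (C a).sum_mem fun p hp => ?_
  rw [← DimVec.mem_splittings.1 hp]
  exact hC.mul_mem _ _ _ _ (hf _) (hg _)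

theorem CoeffsIn.one (hC : IsGradedFamily C) : CoeffsIn C (1 : MvPowerSeries (Fin r) R) :=
  fun a => by
  rw [coeffAt_one]
  split_ifs with h
  · exact h ▸ hC.one_mem
  · exact (C a).zero_mem

theorem CoeffsIn.pow (hC : IsGradedFamily C) {f : MvPowerSeries (Fin r) R} (hf : CoeffsIn C f)
    (n : ℕ) : CoeffsIn C (f ^ n) := by
  induction n with
  | zero => simpa using CoeffsIn.one hC
  | succ n ih => rw [pow_succ]; exact ih.mul hC hf

/-- The equation `g = 1 - (f - 1) g` determines `g` recursively: since `f - 1` has no constant term,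
only coefficients of `g` of smaller degree occur on the right. -/
theorem CoeffsIn.of_mul_eq_one (hC : IsGradedFamily C) {f g : MvPowerSeries (Fin r) R}
    (hf : CoeffsIn C f) (hf0 : coeffAt f 0 = 1) (h : f * g = 1) : CoeffsIn C g := by
  intro a
  induction hn : a.deg using Nat.strong_induction_on generalizing a with
  | _ n ih =>
    have h1 : g = 1 - (f - 1) * g := by rw [sub_mul, h]; noncomm_ring
    rw [h1, coeffAt_sub]
    refine (C a).sub_mem (CoeffsIn.one hC a) ?_
    rw [coeffAt_mul]
    refine (C a).sum_mem fun p hp => ?_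
    have hp := DimVec.mem_splittings.1 hp
    rcases eq_or_ne p.1 0 with h0 | h0
    · rw [h0]
      simp [hf0]
    · have hlt : p.2.deg < n := by
        have := mt DimVec.deg_eq_zero.1 h0
        rw [← hn, ← hp, DimVec.deg_add]
        omega
      rw [← hp]
      exact hC.mul_mem _ _ _ _ ((hf.sub (CoeffsIn.one hC)) _) (ih _ hlt p.2 rfl)

theorem act_mem (hC : IsGradedFamily C) {F : Coll r} {H : DimVec r → R} {a : DimVec r}
    (h : ∀ α ∈ tuples a, F α ≠ 0 → ∀ b ∈ α, H b ∈ C b) : F.act H a ∈ C a := by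
  have key : ∀ α : List (DimVec r), (∀ b ∈ α, H b ∈ C b) → (α.map H).prod ∈ C α.sum := by
    intro α
    induction α with
    | nil => intro _; simpa using hC.one_mem
    | cons b α ih =>
      intro hα
      simp only [List.map_cons, List.prod_cons, List.sum_cons]
      exact hC.mul_mem _ _ _ _ (hα b (by simp)) (ih fun c hc => hα c (by simp [hc]))
  refine (C a).sum_mem fun α hα => ?_
  by_cases hF : F α = 0
  · simp [hF]
  · have := key α (h α hα hF)
    rw [(mem_tuples.1 hα).2] at this
    exact (C a).smul_mem _ this

theorem stackyDT_mem (hC : IsGradedFamily C) (Z : CentralCharge r) {A : DimVec r → R}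
    (hA : ∀ a, a ≠ 0 → A a ∈ C a) : ∀ a, a ≠ 0 → stackyDT Z A a ∈ C a := by
  intro a
  induction hn : a.deg using Nat.strong_induction_on generalizing a with
  | _ n ih =>
    intro ha
    -- Truncating the collection makes the recursive sum an instance of `act_mem`, which asks for
    -- membership only at entries of tuples with nonzero weight; these have smaller degree.
    have h : Coll.act (fun α => if 2 ≤ α.length then hnColl Z α else 0) (stackyDT Z A) a ∈ C a := by
      refine act_mem hC fun α hα hF b hb => ?_
      have h2 : 2 ≤ α.length := by by_contra h; simp [h] at hF
      exact ih b.deg (hn ▸ sum_lt_of_mem_tuples hα h2 hb) b rfl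
        fun h0 => (mem_tuples.1 hα).1 (h0 ▸ hb)
    rw [stackyDT_eq, Finset.sum_filter]
    refine (C a).sub_mem (hA a ha) ?_
    convert h using 1
    refine Finset.sum_congr rfl fun α _ => ?_
    by_cases h2 : 2 ≤ α.length <;> simp only [h2, if_true, if_false, zero_smul]

/-- The family of subspaces equal to `R` in the degrees where `P` holds, and zero elsewhere. -/
noncomputable def supportFamily (R : Type*) [Ring R] [Algebra ℚ R] (P : DimVec r → Prop) :
    DimVec r → Submodule ℚ R :=
  open Classical in fun a => if P a then ⊤ else ⊥

theorem mem_supportFamily {P : DimVec r → Prop} {a : DimVec r} {x : R} :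
    x ∈ supportFamily R P a ↔ (¬ P a → x = 0) := by
  unfold supportFamily
  split_ifs with h <;> simp [h]

/-- Support conditions are encoded as families of subspaces, so that they share the closure lemmas
for products, inverses and actions with the grading of `R`. -/
theorem isGradedFamily_support {P : DimVec r → Prop} (h0 : P 0)
    (hadd : ∀ a b, P a → P b → P (a + b)) : IsGradedFamily (supportFamily R P) where
  one_mem := mem_supportFamily.2 fun h => absurd h0 h
  mul_mem a b x y hx hy := mem_supportFamily.2 fun h => by
    rw [mem_supportFamily] at hx hy
    by_cases ha : P a
    · rw [hy fun hb => h (hadd a b ha hb), mul_zero]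
    · rw [hx ha, zero_mul]

end CoeffsIn

/-! ### The convolution product of collections -/

/-- The convolution product of collections, corresponding to the product of power series. -/
def Coll.conv (F G : Coll r) : Coll r := fun α =>
  ∑ k ∈ Finset.range (α.length + 1), F (α.take k) * G (α.drop k)

/-- The power series whose coefficients are given by the action of a collection. -/
noncomputable def Coll.series (F : Coll r) (H : DimVec r → R) : MvPowerSeries (Fin r) R :=
  seriesOf (F.act H)

@[simp] theorem coeffAt_series (F : Coll r) (H : DimVec r → R) (a : DimVec r) :
    coeffAt (F.series H) a = F.act H a := rfl

/-- Concatenation identifies pairs of tuples with tuples carrying a marked cut. -/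
theorem Coll.series_mul_series (F G : Coll r) (H : DimVec r → R) :
    F.series H * G.series H = (F.conv G).series H := by
  refine series_ext fun a => ?_
  have hl : coeffAt (F.series H * G.series H) a =
      ∑ x ∈ a.splittings.sigma fun p => tuples p.1 ×ˢ tuples p.2,
        (F x.2.1 * G x.2.2) • ((x.2.1 ++ x.2.2).map H).prod := by
    rw [coeffAt_mul, Finset.sum_sigma]
    refine Finset.sum_congr rfl fun p _ => ?_
    rw [coeffAt_series, coeffAt_series, Coll.act, Coll.act, Finset.sum_mul_sum,
      Finset.sum_product]
    refine Finset.sum_congr rfl fun α _ => Finset.sum_congr rfl fun β _ => ?_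
    rw [List.map_append, List.prod_append, smul_mul_smul_comm]
  have hr : coeffAt ((F.conv G).series H) a =
      ∑ x ∈ (tuples a).sigma fun α => Finset.range (α.length + 1),
        (F (x.1.take x.2) * G (x.1.drop x.2)) • (x.1.map H).prod := by
    rw [coeffAt_series, Coll.act, Finset.sum_sigma]
    refine Finset.sum_congr rfl fun α _ => ?_
    rw [Coll.conv, Finset.sum_smul]
  rw [hl, hr]
  refine Finset.sum_bij' (fun x _ => ⟨x.2.1 ++ x.2.2, x.2.1.length⟩)
    (fun x _ => ⟨((x.1.take x.2).sum, (x.1.drop x.2).sum), (x.1.take x.2, x.1.drop x.2)⟩)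
    ?_ ?_ ?_ ?_ ?_
  · rintro ⟨p, α, β⟩ hx
    simp only [Finset.mem_sigma, DimVec.mem_splittings, Finset.mem_product, mem_tuples,
      Finset.mem_range] at hx ⊢
    obtain ⟨rfl, ⟨h1, h2⟩, h3, h4⟩ := hx
    simp [h1, h2, h3, h4]
  · rintro ⟨α, k⟩ hx
    simp only [Finset.mem_sigma, DimVec.mem_splittings, Finset.mem_product, mem_tuples,
      Finset.mem_range] at hx ⊢
    refine ⟨?_, ⟨fun h => hx.1.1 (List.mem_of_mem_take h), trivial⟩,
      fun h => hx.1.1 (List.mem_of_mem_drop h), trivial⟩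
    rw [← List.sum_append, List.take_append_drop, hx.1.2]
  · rintro ⟨⟨p, q⟩, α, β⟩ hx
    simp only [Finset.mem_sigma, DimVec.mem_splittings, Finset.mem_product, mem_tuples] at hx
    obtain ⟨rfl, ⟨h1, rfl⟩, h3, rfl⟩ := hx
    simp
  · rintro ⟨α, k⟩ hx
    simp only [Finset.mem_sigma, Finset.mem_range] at hx
    have : min k α.length = k := by omega
    simp [this]
  · rintro ⟨⟨p, q⟩, α, β⟩ hx
    simp

theorem Coll.act_congr {F G : Coll r} {H K : DimVec r → R} {a : DimVec r}
    (h : ∀ α ∈ tuples a, F α = G α) (h' : ∀ b, b ≠ 0 → H b = K b) : F.act H a = G.act K a := by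
  refine Finset.sum_congr rfl fun α hα => ?_
  rw [h α hα]
  congr 2
  exact List.map_congr_left fun b hb => h' b fun h0 => (mem_tuples.1 hα).1 (h0 ▸ hb)

theorem Coll.series_congr {F G : Coll r} {H K : DimVec r → R}
    (h : ∀ α : List (DimVec r), 0 ∉ α → F α = G α) (h' : ∀ b, b ≠ 0 → H b = K b) :
    F.series H = G.series K :=
  series_ext fun _ => Coll.act_congr (fun α hα => h α (mem_tuples.1 hα).1) h'

theorem tuples_zero : tuples (0 : DimVec r) = {[]} := by
  ext α
  rw [mem_tuples, Finset.mem_singleton]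
  refine ⟨fun ⟨h0, h⟩ => ?_, by rintro rfl; simp⟩
  have := DimVec.length_le_of_sum_eq α h0
  rw [h] at this
  simpa using this

theorem Coll.act_zero (F : Coll r) (H : DimVec r → R) : F.act H 0 = F [] • 1 := by
  simp [Coll.act, tuples_zero]

/-- The collection supported on tuples of length `n`, with value one. -/
def lengthColl (r n : ℕ) : Coll r := fun α => if α.length = n then 1 else 0

theorem lengthColl_one_series {H : DimVec r → R} (h0 : H 0 = 0) :
    (lengthColl r 1).series H = seriesOf H := by
  refine series_ext fun a => ?_
  rw [coeffAt_series, coeffAt_seriesOf]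
  rcases eq_or_ne a 0 with rfl | ha
  · simp [Coll.act_zero, lengthColl, h0]
  · rw [Coll.act, Finset.sum_eq_single [a]]
    · simp [lengthColl]
    · intro α hα hne
      rw [lengthColl, if_neg, zero_smul]
      intro h
      obtain ⟨b, rfl⟩ := List.length_eq_one_iff.1 h
      have := (mem_tuples.1 hα).2
      simp at this
      exact hne (by rw [this])
    · intro h
      exact absurd (mem_tuples.2 ⟨by simpa using ha.symm, by simp⟩) h

theorem lengthColl_zero_series (H : DimVec r → R) : (lengthColl r 0).series H = 1 := by
  refine series_ext fun a => ?_
  rw [coeffAt_series, coeffAt_one]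
  split_ifs with h
  · rw [h, Coll.act_zero]; simp [lengthColl]
  · refine Finset.sum_eq_zero fun α hα => ?_
    rw [lengthColl, if_neg, zero_smul]
    intro hl
    rw [List.length_eq_zero_iff.1 hl, mem_tuples] at hα
    exact h hα.2.symm

theorem Coll.conv_lengthColl_one (F : Coll r) (α : List (DimVec r)) :
    F.conv (lengthColl r 1) α = if α = [] then 0 else F α.dropLast := by
  split_ifs with h
  · simp [h, Coll.conv, lengthColl]
  · have hl := List.length_pos_iff.2 h
    rw [Coll.conv, Finset.sum_eq_single (α.length - 1)]
    · have : α.length - (α.length - 1) = 1 := by omega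
      simp [lengthColl, this, List.dropLast_eq_take]
    · intro k hk hne
      rw [Finset.mem_range] at hk
      have : ¬ α.length - k = 1 := by omega
      simp [lengthColl, this]
    · intro h'
      simp at h'

theorem seriesOf_pow {H : DimVec r → R} (h0 : H 0 = 0) (n : ℕ) :
    seriesOf H ^ n = (lengthColl r n).series H := by
  induction n with
  | zero => rw [pow_zero, lengthColl_zero_series]
  | succ n ih =>
    rw [pow_succ, ih, ← lengthColl_one_series h0, Coll.series_mul_series]
    refine Coll.series_congr (fun α _ => ?_) fun _ _ => rfl
    rw [Coll.conv_lengthColl_one]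
    split_ifs with h
    · simp [h, lengthColl]
    · have hl := List.length_pos_iff.2 h
      simp only [lengthColl, List.length_dropLast]
      congr 1
      rw [eq_iff_iff]
      omega

/-- Each of the `n` factors `f` contributes degree at least one. This makes all geometric and
logarithmic series finite at a given `γ`. -/
theorem coeffAt_mul_pow_eq_zero {f g : MvPowerSeries (Fin r) R} (hf : coeffAt f 0 = 0) {n : ℕ}
    {a : DimVec r} (h : a.deg < n) : coeffAt (g * f ^ n) a = 0 := by
  have key : ∀ b : DimVec r, b.deg < n → coeffAt (f ^ n) b = 0 := by
    intro b hb
    have : f = seriesOf (coeffAt f) := series_ext fun _ => rfl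
    rw [this, seriesOf_pow hf, coeffAt_series]
    refine Finset.sum_eq_zero fun α hα => ?_
    obtain ⟨h0, rfl⟩ := mem_tuples.1 hα
    have := DimVec.length_le_of_sum_eq α h0
    rw [lengthColl, if_neg, zero_smul]
    unfold DimVec.deg at hb
    omega
  rw [coeffAt_mul]
  refine Finset.sum_eq_zero fun p hp => ?_
  rw [← DimVec.mem_splittings.1 hp, DimVec.deg_add] at h
  rw [key p.2 (by omega), mul_zero]

end Series

/-! ### Factorization with respect to a slope -/

namespace CentralCharge

variable {r : ℕ}

/-- The additive function whose sign at `a` compares the slope of `a` with the slope of `γ`. -/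
noncomputable def offset (Z : CentralCharge r) (γ : DimVec r) : DimVec r →+ ℝ where
  toFun a := (∑ k, Z.θ k * a k) * (∑ k, Z.ρ k * γ k) - (∑ k, Z.θ k * γ k) * (∑ k, Z.ρ k * a k)
  map_zero' := by simp
  map_add' a b := by
    simp only [Pi.add_apply, Nat.cast_add, mul_add, Finset.sum_add_distrib]
    ring

theorem offset_apply (Z : CentralCharge r) (γ a : DimVec r) : Z.offset γ a =
    (∑ k, Z.θ k * a k) * (∑ k, Z.ρ k * γ k) - (∑ k, Z.θ k * γ k) * (∑ k, Z.ρ k * a k) := rfl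

theorem offset_self (Z : CentralCharge r) (γ : DimVec r) : Z.offset γ γ = 0 := sub_self _

theorem offset_pos_iff (Z : CentralCharge r) {γ a : DimVec r} (hγ : γ ≠ 0) (ha : a ≠ 0) :
    0 < Z.offset γ a ↔ Z.slope γ < Z.slope a := by
  rw [slope, slope, div_lt_div_iff₀ (Z.rho_pos hγ) (Z.rho_pos ha), offset_apply, sub_pos]

theorem offset_neg_iff (Z : CentralCharge r) {γ a : DimVec r} (hγ : γ ≠ 0) (ha : a ≠ 0) :
    Z.offset γ a < 0 ↔ Z.slope a < Z.slope γ := by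
  rw [slope, slope, div_lt_div_iff₀ (Z.rho_pos ha) (Z.rho_pos hγ), offset_apply, sub_neg]

theorem offset_eq_zero_iff (Z : CentralCharge r) {γ a : DimVec r} (hγ : γ ≠ 0) (ha : a ≠ 0) :
    Z.offset γ a = 0 ↔ Z.slope a = Z.slope γ := by
  rw [slope, slope, div_eq_div_iff (Z.rho_pos ha).ne' (Z.rho_pos hγ).ne', offset_apply, sub_eq_zero]

/-- A sum of vectors of one common slope has that slope, because `offset` is additive. -/
theorem pairwise_equiv_iff (Z : CentralCharge r) {γ : DimVec r} (hγ : γ ≠ 0)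
    {α : List (DimVec r)} (hα : α ∈ tuples γ) :
    α.Pairwise Z.Equiv ↔ ∀ a ∈ α, Z.offset γ a = 0 := by
  obtain ⟨h0, hs⟩ := mem_tuples.1 hα
  have hne : ∀ a ∈ α, a ≠ 0 := fun a ha h => h0 (h ▸ ha)
  constructor
  · intro h
    cases α with
    | nil => simp
    | cons b α =>
      have hb := hne b (by simp)
      have h1 : ∀ a ∈ b :: α, Z.slope a = Z.slope b := by
        intro a ha
        rcases List.mem_cons.1 ha with rfl | ha
        · rfl
        · exact ((List.pairwise_cons.1 h).1 a ha).symm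
      have h2 : Z.offset b γ = 0 := by
        rw [← hs, map_list_sum]
        refine List.sum_eq_zero fun x hx => ?_
        obtain ⟨a, ha, rfl⟩ := List.mem_map.1 hx
        exact (Z.offset_eq_zero_iff hb (hne a ha)).2 (h1 a ha)
      intro a ha
      rw [Z.offset_eq_zero_iff hγ (hne a ha), h1 a ha, (Z.offset_eq_zero_iff hb hγ).1 h2]
  · intro h
    refine List.pairwise_of_forall_mem_list fun a ha b hb => ?_
    exact ((Z.offset_eq_zero_iff hγ (hne a ha)).1 (h a ha)).trans
      ((Z.offset_eq_zero_iff hγ (hne b hb)).1 (h b hb)).symm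

end CentralCharge

section Factorization

variable {r : ℕ}

open Classical in
/-- The Harder-Narasimhan collection, restricted to tuples with slopes in `J`. -/
noncomputable def hnCollOn (Z : CentralCharge r) (J : Set ℝ) : Coll r := fun α =>
  if α.Pairwise (fun a b => Z.Lt b a) ∧ ∀ a ∈ α, Z.slope a ∈ J then 1 else 0

theorem hnCollOn_congr {Z : CentralCharge r} {J K : Set ℝ} {α β : List (DimVec r)}
    (h : (α.Pairwise (fun a b => Z.Lt b a) ∧ ∀ a ∈ α, Z.slope a ∈ J) ↔
      (β.Pairwise (fun a b => Z.Lt b a) ∧ ∀ a ∈ β, Z.slope a ∈ K)) :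
    hnCollOn Z J α = hnCollOn Z K β := by
  unfold hnCollOn
  congr 1
  exact propext h

theorem hnCollOn_nil (Z : CentralCharge r) (J : Set ℝ) : hnCollOn Z J [] = 1 := by
  simp [hnCollOn]

theorem hnCollOn_univ (Z : CentralCharge r) : hnCollOn Z Set.univ = hnColl Z := by
  funext α
  unfold hnCollOn hnColl
  congr 1
  simp

theorem Coll.conv_cons (F G : Coll r) (a : DimVec r) (α : List (DimVec r)) :
    F.conv G (a :: α) = F [] * G (a :: α) + Coll.conv (fun β => F (a :: β)) G α := by
  simp only [Coll.conv, List.length_cons]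
  rw [Finset.sum_range_succ']
  simp [add_comm]

/-- A tuple of decreasing slopes in `J ∪ K` has exactly one cut with all slopes before it in `J` and
all slopes after it in `K`. The induction is on the first entry: if its slope is in `J` it joins the
prefix, otherwise only the empty prefix contributes. -/
theorem hnCollOn_union (Z : CentralCharge r) {J K : Set ℝ} (h : ∀ x ∈ J, ∀ y ∈ K, y < x) :
    ∀ α, (hnCollOn Z J).conv (hnCollOn Z K) α = hnCollOn Z (J ∪ K) α := by
  intro α
  induction α with
  | nil => simp [Coll.conv, hnCollOn]
  | cons a α ih =>
    rw [Coll.conv_cons, hnCollOn_nil, one_mul]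
    by_cases haJ : Z.slope a ∈ J
    · have haK : Z.slope a ∉ K := fun hK => lt_irrefl _ (h _ haJ _ hK)
      have h1 : hnCollOn Z K (a :: α) = 0 := by simp [hnCollOn, haK]
      rw [h1, zero_add]
      by_cases hlt : ∀ b ∈ α, Z.Lt b a
      · have h2 : hnCollOn Z (J ∪ K) (a :: α) = hnCollOn Z (J ∪ K) α := by
          refine hnCollOn_congr ?_
          rw [List.pairwise_cons, List.forall_mem_cons]
          simp only [Set.mem_union, haJ, true_or, true_and, and_iff_right hlt]
        rw [h2, ← ih]
        refine Finset.sum_congr rfl fun k _ => ?_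
        congr 1
        refine hnCollOn_congr ?_
        rw [List.pairwise_cons, List.forall_mem_cons]
        simp only [haJ, true_and, and_iff_right fun b hb => hlt b (List.mem_of_mem_take hb)]
      · have h2 : hnCollOn Z (J ∪ K) (a :: α) = 0 := by
          simp [hnCollOn, List.pairwise_cons, hlt]
        rw [h2]
        refine Finset.sum_eq_zero fun k _ => ?_
        by_contra hne
        obtain ⟨h3, h4⟩ := mul_ne_zero_iff.1 hne
        simp only [hnCollOn, ne_eq, ite_eq_right_iff, one_ne_zero, imp_false, not_not] at h3 h4
        refine hlt fun b hb => ?_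
        rw [← List.take_append_drop k α, List.mem_append] at hb
        rcases hb with hb | hb
        · exact (List.pairwise_cons.1 h3.1).1 b hb
        · exact h _ haJ _ (h4.2 b hb)
    · have h1 : Coll.conv (fun β => hnCollOn Z J (a :: β)) (hnCollOn Z K) α = 0 := by
        refine Finset.sum_eq_zero fun k _ => ?_
        simp [hnCollOn, haJ]
      rw [h1, add_zero]
      unfold hnCollOn
      congr 1
      rw [eq_iff_iff]
      refine and_congr_right fun hp => ⟨fun hK b hb => Or.inr (hK b hb), fun hJK b hb => ?_⟩
      rcases hJK b hb with hbJ | hbK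
      · exfalso
        have haK : Z.slope a ∈ K := (hJK a (by simp)).resolve_left haJ
        rcases List.mem_cons.1 hb with rfl | hb
        · exact haJ hbJ
        · exact lt_asymm (h _ hbJ _ haK) ((List.pairwise_cons.1 hp).1 b hb)
      · exact hbK

variable {R : Type*} [Ring R] [Algebra ℚ R]

open Classical in
/-- The power series without constant term with coefficients given by `H`. -/
noncomputable def augSeries (H : DimVec r → R) : MvPowerSeries (Fin r) R :=
  seriesOf fun a => if a = 0 then 0 else H a

@[simp] theorem coeffAt_augSeries_zero (H : DimVec r → R) : coeffAt (augSeries H) 0 = 0 := by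
  simp [augSeries]

theorem coeffAt_augSeries (H : DimVec r → R) {a : DimVec r} (ha : a ≠ 0) :
    coeffAt (augSeries H) a = H a := by
  simp [augSeries, ha]

theorem coeffAt_augSeries_pow (H : DimVec r → R) (n : ℕ) (a : DimVec r) :
    coeffAt (augSeries H ^ n) a = (lengthColl r n).act H a := by
  rw [augSeries, seriesOf_pow (H := fun a => if a = 0 then 0 else H a) (if_pos rfl), coeffAt_series]
  exact Coll.act_congr (fun _ _ => rfl) fun b hb => if_neg hb

theorem lengthColl_one_series_eq (H : DimVec r → R) :
    (lengthColl r 1).series H = augSeries H :=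
  series_ext fun a => by rw [← pow_one (augSeries H), coeffAt_augSeries_pow, coeffAt_series]

open Classical in
/-- The part of `A_Z` of the same slope as `γ`. -/
noncomputable def slopePart (Z : CentralCharge r) (A : DimVec r → R) (γ a : DimVec r) : R :=
  if Z.offset γ a = 0 then stackyDT Z A a else 0

theorem hnColl_series_stackyDT (Z : CentralCharge r) (A : DimVec r → R) :
    (hnColl Z).series (stackyDT Z A) = 1 + augSeries A := by
  refine series_ext fun a => ?_
  rw [coeffAt_series, coeffAt_add, coeffAt_one]
  split_ifs with h
  · rw [h, Coll.act_zero]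
    simp [hnColl]
  · rw [hnColl_act_stackyDT Z A h, coeffAt_augSeries A h, zero_add]

theorem hnCollOn_singleton_series (Z : CentralCharge r) (A : DimVec r → R) {γ : DimVec r}
    (hγ : γ ≠ 0) :
    (hnCollOn Z {Z.slope γ}).series (stackyDT Z A) = 1 + augSeries (slopePart Z A γ) := by
  refine series_ext fun a => ?_
  rw [coeffAt_series, coeffAt_add, coeffAt_one]
  split_ifs with h
  · rw [h, Coll.act_zero]
    simp [hnCollOn]
  · rw [coeffAt_augSeries _ h, zero_add, Coll.act, Finset.sum_eq_single [a]]
    · simp only [hnCollOn, List.pairwise_singleton, List.mem_singleton, forall_eq, true_and,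
        Set.mem_singleton_iff, slopePart, Z.offset_eq_zero_iff hγ h, List.map_singleton,
        List.prod_singleton]
      split_ifs <;> simp
    · intro α hα hne
      obtain ⟨h0, hs⟩ := mem_tuples.1 hα
      rw [hnCollOn, if_neg, zero_smul]
      rintro ⟨hp, hm⟩
      match α, hs, hne, hp, hm with
      | [], hs, _, _, _ => exact h hs.symm
      | [b], hs, hne, _, _ => exact hne (by simpa using hs)
      | b :: c :: l, _, _, hp, hm =>
        have h1 : Z.slope b = Z.slope γ := hm b (by simp)
        have h2 : Z.slope c = Z.slope γ := hm c (by simp)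
        have h3 : Z.slope c < Z.slope b := (List.pairwise_cons.1 hp).1 c (by simp)
        rw [h1, h2] at h3
        exact lt_irrefl _ h3
    · intro hmem
      exact absurd (mem_tuples.2 ⟨by simpa using Ne.symm h, by simp⟩) hmem

/-- The factor of larger slope than `γ` in the factorization of `1 + A`. -/
noncomputable def upperFactor (Z : CentralCharge r) (A : DimVec r → R) (γ : DimVec r) :
    MvPowerSeries (Fin r) R :=
  (hnCollOn Z (Set.Ioi (Z.slope γ))).series (stackyDT Z A)

/-- The factor of smaller slope than `γ` in the factorization of `1 + A`. -/
noncomputable def lowerFactor (Z : CentralCharge r) (A : DimVec r → R) (γ : DimVec r) :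
    MvPowerSeries (Fin r) R :=
  (hnCollOn Z (Set.Iio (Z.slope γ))).series (stackyDT Z A)

theorem coeffAt_upperFactor_zero (Z : CentralCharge r) (A : DimVec r → R) (γ : DimVec r) :
    coeffAt (upperFactor Z A γ) 0 = 1 := by
  rw [upperFactor, coeffAt_series, Coll.act_zero, hnCollOn_nil, one_smul]

theorem coeffAt_lowerFactor_zero (Z : CentralCharge r) (A : DimVec r → R) (γ : DimVec r) :
    coeffAt (lowerFactor Z A γ) 0 = 1 := by
  rw [lowerFactor, coeffAt_series, Coll.act_zero, hnCollOn_nil, one_smul]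

/-- The factorization of `1 + A` into parts of larger, equal and smaller slope than `γ`. -/
theorem slope_factorization (Z : CentralCharge r) (A : DimVec r → R) {γ : DimVec r}
    (hγ : γ ≠ 0) :
    upperFactor Z A γ * (1 + augSeries (slopePart Z A γ)) * lowerFactor Z A γ =
      1 + augSeries A := by
  rw [← hnCollOn_singleton_series Z A hγ, ← hnColl_series_stackyDT Z A, ← hnCollOn_univ,
    upperFactor, lowerFactor, mul_assoc, Coll.series_mul_series, Coll.series_mul_series]
  congr 1
  have h1 : Coll.conv (hnCollOn Z {Z.slope γ}) (hnCollOn Z (Set.Iio (Z.slope γ))) =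
      hnCollOn Z (Set.Iic (Z.slope γ)) := by
    funext α
    rw [hnCollOn_union]
    · congr 1; exact Set.Iio_insert
    · rintro x rfl y hy; exact hy
  funext α
  rw [h1, hnCollOn_union]
  · congr 1; ext x; simp
  · intro x hx y hy; exact lt_of_le_of_lt hy hx

theorem coeffsIn_one_add_augSeries {C : DimVec r → Submodule ℚ R} (hC : IsGradedFamily C)
    {H : DimVec r → R} (hH : ∀ a, a ≠ 0 → H a ∈ C a) : CoeffsIn C (1 + augSeries H) := by
  refine (CoeffsIn.one hC).add fun a => ?_
  rcases eq_or_ne a 0 with rfl | ha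
  · rw [coeffAt_augSeries_zero]; exact zero_mem _
  · rw [coeffAt_augSeries H ha]; exact hH a ha

theorem coeffsIn_upperFactor {C : DimVec r → Submodule ℚ R} (hC : IsGradedFamily C)
    (Z : CentralCharge r) {A : DimVec r → R} (hA : ∀ a, a ≠ 0 → A a ∈ C a) (γ : DimVec r) :
    CoeffsIn C (upperFactor Z A γ) := fun _ =>
  act_mem hC fun _ hα _ b hb => stackyDT_mem hC Z hA b fun h => (mem_tuples.1 hα).1 (h ▸ hb)

theorem coeffsIn_lowerFactor {C : DimVec r → Submodule ℚ R} (hC : IsGradedFamily C)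
    (Z : CentralCharge r) {A : DimVec r → R} (hA : ∀ a, a ≠ 0 → A a ∈ C a) (γ : DimVec r) :
    CoeffsIn C (lowerFactor Z A γ) := fun _ =>
  act_mem hC fun _ hα _ b hb => stackyDT_mem hC Z hA b fun h => (mem_tuples.1 hα).1 (h ▸ hb)

theorem slopePart_mem {C : DimVec r → Submodule ℚ R} (hC : IsGradedFamily C)
    (Z : CentralCharge r) {A : DimVec r → R} (hA : ∀ a, a ≠ 0 → A a ∈ C a) (γ : DimVec r) :
    ∀ a, a ≠ 0 → slopePart Z A γ a ∈ C a := by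
  intro a ha
  unfold slopePart
  split_ifs
  · exact stackyDT_mem hC Z hA a ha
  · exact zero_mem _

theorem isGradedFamily_support_pos (ψ : DimVec r →+ ℝ) :
    IsGradedFamily (supportFamily R fun a => a = 0 ∨ 0 < ψ a) :=
  isGradedFamily_support (Or.inl rfl) fun a b ha hb => by
    rcases ha with rfl | ha <;> rcases hb with rfl | hb
    · simp
    · simp [hb]
    · simp [ha]
    · exact Or.inr (by rw [map_add]; exact add_pos ha hb)

theorem upperFactor_support (Z : CentralCharge r) (A : DimVec r → R) {γ : DimVec r}
    (hγ : γ ≠ 0) :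
    CoeffsIn (supportFamily R fun a => a = 0 ∨ 0 < Z.offset γ a) (upperFactor Z A γ) := by
  refine fun _ => act_mem (isGradedFamily_support_pos _) fun α hα h b hb => ?_
  refine mem_supportFamily.2 fun hb' => absurd (Or.inr ?_) hb'
  simp only [hnCollOn, ne_eq, ite_eq_right_iff, one_ne_zero, imp_false, not_not] at h
  exact (Z.offset_pos_iff hγ fun h => (mem_tuples.1 hα).1 (h ▸ hb)).2 (h.2 b hb)

theorem isGradedFamily_support_neg (ψ : DimVec r →+ ℝ) :
    IsGradedFamily (supportFamily R fun a => a = 0 ∨ ψ a < 0) := by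
  simpa using isGradedFamily_support_pos (R := R) (-ψ)

theorem lowerFactor_support (Z : CentralCharge r) (A : DimVec r → R) {γ : DimVec r}
    (hγ : γ ≠ 0) :
    CoeffsIn (supportFamily R fun a => a = 0 ∨ Z.offset γ a < 0) (lowerFactor Z A γ) := by
  refine fun _ => act_mem (isGradedFamily_support_neg _) fun α hα h b hb => ?_
  refine mem_supportFamily.2 fun hb' => absurd (Or.inr ?_) hb'
  simp only [hnCollOn, ne_eq, ite_eq_right_iff, one_ne_zero, imp_false, not_not] at h
  exact (Z.offset_neg_iff hγ fun h => (mem_tuples.1 hα).1 (h ▸ hb)).2 (h.2 b hb)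

/-! ### Rational invariants as coefficients of a logarithm -/

/-- The coefficient of `log (1 + x)` at `γ`. -/
noncomputable def logCoeff (x : MvPowerSeries (Fin r) R) (γ : DimVec r) : R :=
  ∑ k ∈ Finset.range γ.deg, ((-1) ^ k / (k + 1 : ℚ)) • coeffAt (x ^ (k + 1)) γ

/-- A tuple of sum `γ` with entries of equal slope has all entries of the slope of `γ`, so the
tuples counted by `log_Z` are those contributing to powers of `slopePart`. The power is the length
of the tuple. -/
theorem rationalDT_eq_logCoeff (Z : CentralCharge r) (A : DimVec r → R) {γ : DimVec r}
    (hγ : γ ≠ 0) : rationalDT Z A γ = logCoeff (augSeries (slopePart Z A γ)) γ := by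
  simp only [logCoeff, coeffAt_augSeries_pow, Coll.act, Finset.smul_sum]
  rw [Finset.sum_comm]
  refine Finset.sum_congr rfl fun α hα => ?_
  obtain ⟨h0, hs⟩ := mem_tuples.1 hα
  have hl : 1 ≤ α.length := by
    rw [Nat.one_le_iff_ne_zero]
    intro h
    rw [List.length_eq_zero_iff.1 h] at hs
    exact hγ hs.symm
  have hl' : α.length ≤ γ.deg := by
    have := DimVec.length_le_of_sum_eq α h0
    rwa [hs] at this
  rw [Finset.sum_eq_single (α.length - 1)]
  · have h1 : α.length - 1 + 1 = α.length := by omega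
    have h2 : ((α.length - 1 : ℕ) : ℚ) + 1 = α.length := by exact_mod_cast h1
    rw [h1, h2, lengthColl, if_pos rfl, one_smul, logColl]
    by_cases hp : α.Pairwise Z.Equiv
    · rw [if_pos hp]
      rw [Z.pairwise_equiv_iff hγ hα] at hp
      congr 2
      exact List.map_congr_left fun a ha => by rw [slopePart, if_pos (hp a ha)]
    · rw [if_neg hp, zero_smul]
      rw [Z.pairwise_equiv_iff hγ hα] at hp
      push Not at hp
      obtain ⟨a, ha, hne⟩ := hp
      obtain ⟨l₁, l₂, rfl⟩ := List.append_of_mem ha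
      have : slopePart Z A γ a = 0 := if_neg hne
      simp [this]
  · intro k _ hk
    rw [lengthColl, if_neg (by omega), zero_smul, smul_zero]
  · intro h
    rw [Finset.mem_range] at h
    omega

/-! ### Uniqueness of factorizations -/

/-- Only the splitting `a + 0` survives. Applied to the difference of two series, this isolates the
first degree in which they might differ. -/
theorem coeffAt_mul_of_vanishing_left {d f : MvPowerSeries (Fin r) R} {a : DimVec r}
    (hd : ∀ b < a, coeffAt d b = 0) (hf : coeffAt f 0 = 1) :
    coeffAt (d * f) a = coeffAt d a := by
  rw [coeffAt_mul, Finset.sum_eq_single (a, 0)]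
  · rw [hf, mul_one]
  · rintro ⟨p, q⟩ hp hne
    have hp := DimVec.mem_splittings.1 hp
    rw [hd p, zero_mul]
    refine lt_of_le_of_ne (hp ▸ le_self_add) ?_
    rintro rfl
    exact hne (by simpa using hp)
  · intro h
    exact absurd (DimVec.mem_splittings.2 (add_zero a)) h

theorem coeffAt_mul_of_vanishing_right {d f : MvPowerSeries (Fin r) R} {a : DimVec r}
    (hd : ∀ b < a, coeffAt d b = 0) (hf : coeffAt f 0 = 1) :
    coeffAt (f * d) a = coeffAt d a := by
  rw [coeffAt_mul, Finset.sum_eq_single (0, a)]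
  · rw [hf, one_mul]
  · rintro ⟨p, q⟩ hp hne
    have hp := DimVec.mem_splittings.1 hp
    rw [hd q, mul_zero]
    refine lt_of_le_of_ne (hp ▸ le_add_self) ?_
    rintro rfl
    exact hne (by simpa using hp)
  · intro h
    exact absurd (DimVec.mem_splittings.2 (zero_add a)) h

/-- A factorization into factors supported on `ψ > 0`, `ψ = 0` and `ψ < 0` is unique, and this
remains true if only the degrees `≤ γ` are considered. -/
theorem factorization_unique (ψ : DimVec r → ℝ) (γ : DimVec r)
    {u u₀ u' v v₀ v' : MvPowerSeries (Fin r) R}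
    (h : u * u₀ * u' = v * v₀ * v')
    (hu : coeffAt u 0 = 1) (hu₀ : coeffAt u₀ 0 = 1) (hu' : coeffAt u' 0 = 1)
    (hv : coeffAt v 0 = 1) (hv₀ : coeffAt v₀ 0 = 1) (hv' : coeffAt v' 0 = 1)
    (su : ∀ a ≤ γ, a ≠ 0 → ¬ 0 < ψ a → coeffAt u a = 0 ∧ coeffAt v a = 0)
    (su₀ : ∀ a ≤ γ, a ≠ 0 → ¬ ψ a = 0 → coeffAt u₀ a = 0 ∧ coeffAt v₀ a = 0)
    (su' : ∀ a ≤ γ, a ≠ 0 → ¬ ψ a < 0 → coeffAt u' a = 0 ∧ coeffAt v' a = 0) :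
    ∀ a ≤ γ, coeffAt (u - v) a = 0 ∧ coeffAt (u₀ - v₀) a = 0 ∧ coeffAt (u' - v') a = 0 := by
  intro a
  induction hn : a.deg using Nat.strong_induction_on generalizing a with
  | _ n ih =>
    intro ha
    rcases eq_or_ne a 0 with rfl | h0
    · simp [*]
    have ih' : ∀ b < a, coeffAt (u - v) b = 0 ∧ coeffAt (u₀ - v₀) b = 0 ∧
        coeffAt (u' - v') b = 0 := fun b hb =>
      ih b.deg (hn ▸ DimVec.deg_lt_of_lt hb) b rfl (hb.le.trans ha)
    -- The difference of the two products telescopes; at the degree `a` each summand reduces to the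
    -- coefficient of its own difference, so the three coefficients sum to zero.
    have e : (u - v) * (u₀ * u') + v * ((u₀ - v₀) * u') + (v * v₀) * (u' - v') = 0 := by
      have : (u - v) * (u₀ * u') + v * ((u₀ - v₀) * u') + (v * v₀) * (u' - v') =
        u * u₀ * u' - v * v₀ * v' := by noncomm_ring
      rw [this, h, sub_self]
    have e' := congrArg (fun f => coeffAt f a) e
    have hs : coeffAt ((u₀ - v₀) * u') a = coeffAt (u₀ - v₀) a :=
      coeffAt_mul_of_vanishing_left (fun b hb => (ih' b hb).2.1) hu'
    have hs' : ∀ b < a, coeffAt ((u₀ - v₀) * u') b = 0 := fun b hb => by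
      rw [coeffAt_mul_of_vanishing_left (fun c hc => (ih' c (hc.trans hb)).2.1) hu',
        (ih' b hb).2.1]
    simp only [coeffAt_add, coeffAt_zero] at e'
    rw [coeffAt_mul_of_vanishing_left (fun b hb => (ih' b hb).1)
        (by rw [coeffAt_mul_zero, hu₀, hu', one_mul]),
      coeffAt_mul_of_vanishing_right hs' hv, hs,
      coeffAt_mul_of_vanishing_right (fun b hb => (ih' b hb).2.2)
        (by rw [coeffAt_mul_zero, hv, hv₀, one_mul])] at e'
    have d : ¬ 0 < ψ a → coeffAt (u - v) a = 0 := fun hh => by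
      rw [coeffAt_sub, (su a ha h0 hh).1, (su a ha h0 hh).2, sub_zero]
    have d₀ : ¬ ψ a = 0 → coeffAt (u₀ - v₀) a = 0 := fun hh => by
      rw [coeffAt_sub, (su₀ a ha h0 hh).1, (su₀ a ha h0 hh).2, sub_zero]
    have d' : ¬ ψ a < 0 → coeffAt (u' - v') a = 0 := fun hh => by
      rw [coeffAt_sub, (su' a ha h0 hh).1, (su' a ha h0 hh).2, sub_zero]
    -- The sign of `ψ a` allows only one of the three differences to be nonzero at `a`, and then the
    -- sum being zero forces that one to vanish too.
    rcases lt_trichotomy (ψ a) 0 with hlt | heq | hgt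
    · rw [d hlt.not_gt, d₀ hlt.ne, zero_add, zero_add] at e'
      exact ⟨d hlt.not_gt, d₀ hlt.ne, e'⟩
    · rw [d heq.not_gt, d' heq.not_lt, zero_add, add_zero] at e'
      exact ⟨d heq.not_gt, e', d' heq.not_lt⟩
    · rw [d₀ hgt.ne', d' hgt.not_gt, add_zero, add_zero] at e'
      exact ⟨e', d₀ hgt.ne', d' hgt.not_gt⟩

end Factorization

/-! ### The tree-level collections and the logarithm -/

section Deformation

variable {r : ℕ} {R : Type*} [Ring R] [Algebra ℚ R]

/-- The series `a` with `1 + A = (1 - t a)⁻¹ (1 - (t - 1) a)`. -/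
theorem exists_deformation (A : DimVec r → R) (t : ℚ) : ∃ a : DimVec r → R,
    (1 - t • augSeries a) * (1 + augSeries A) = 1 - (t - 1) • augSeries a := by
  obtain ⟨g, -, hg, -⟩ := exists_inverse (f := 1 + t • augSeries A) (by simp)
  have hE : augSeries (coeffAt (augSeries A * g)) = augSeries A * g := by
    refine series_ext fun a => ?_
    rcases eq_or_ne a 0 with rfl | ha
    · simp [coeffAt_mul_zero]
    · rw [coeffAt_augSeries _ ha]
  -- Expanding the required identity gives `A = a (1 + t A)`, whence `a = A (1 + t A)⁻¹`.
  refine ⟨coeffAt (augSeries A * g), ?_⟩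
  rw [hE]
  set S := augSeries A
  have h : S * g + t • (S * g * S) = S := by
    have : S * g * (1 + t • S) = S := by rw [mul_assoc, hg, mul_one]
    rwa [mul_add, mul_one, mul_smul_comm] at this
  have h' : (1 - t • (S * g)) * (1 + S) = 1 + S - t • (S * g) - t • (S * g * S) := by
    rw [sub_mul, one_mul, mul_add, mul_one, smul_mul_assoc]
    abel
  rw [h', sub_smul, one_smul]
  nth_rewrite 1 [← h]
  abel

/-- The weight of a step ending at height `x`. -/
noncomputable def stepWeight (t s : ℚ) (x : ℝ) : ℚ :=
  open Classical in if 0 < x then t - 1 else if x < 0 then t else s + t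

/-- The product of the weights of all nonempty initial segments of a tuple. -/
noncomputable def pathColl (ψ : DimVec r →+ ℝ) (t s : ℚ) : Coll r := fun α =>
  ∏ k ∈ Finset.Ico 1 (α.length + 1), stepWeight t s (ψ (α.take k).sum)

theorem pathColl_dropLast (ψ : DimVec r →+ ℝ) (t s : ℚ) {α : List (DimVec r)} (h : α ≠ []) :
    pathColl ψ t s α.dropLast =
      ∏ k ∈ Finset.Ico 1 α.length, stepWeight t s (ψ (α.take k).sum) := by
  have hl := List.length_pos_iff.2 h
  have h1 : α.length - 1 + 1 = α.length := by omega
  rw [pathColl, List.length_dropLast, h1]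
  refine Finset.prod_congr rfl fun k hk => ?_
  rw [Finset.mem_Ico] at hk
  rw [List.dropLast_eq_take, List.take_take, min_eq_left (by omega)]

theorem pathColl_eq (ψ : DimVec r →+ ℝ) (t s : ℚ) {α : List (DimVec r)} (h : α ≠ []) :
    pathColl ψ t s α = stepWeight t s (ψ α.sum) * pathColl ψ t s α.dropLast := by
  have hl := List.length_pos_iff.2 h
  rw [pathColl_dropLast ψ t s h, pathColl, Finset.prod_Ico_succ_top (by omega), List.take_length,
    mul_comm]

theorem prod_stepWeight (t s : ℚ) {ι : Type*} (I : Finset ι) (x : ι → ℝ)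
    [DecidablePred fun i => 0 < x i] [DecidablePred fun i => x i < 0]
    [DecidablePred fun i => x i = 0] :
    ∏ i ∈ I, stepWeight t s (x i) = t ^ (I.filter fun i => x i < 0).card *
      (t - 1) ^ (I.filter fun i => 0 < x i).card * (s + t) ^ (I.filter fun i => x i = 0).card := by
  have h : ∀ i ∈ I, stepWeight t s (x i) = (if x i < 0 then t else 1) *
      (if 0 < x i then t - 1 else 1) * (if x i = 0 then s + t else 1) := by
    intro i _
    unfold stepWeight
    rcases lt_trichotomy (x i) 0 with h | h | h
    · simp [h, h.not_gt, h.ne]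
    · simp [h]
    · simp [h, h.not_gt, h.ne']
  rw [Finset.prod_congr rfl h]
  simp only [Finset.prod_mul_distrib, Finset.prod_ite, Finset.prod_const, one_pow, mul_one]

/-- The part of a series supported on `ψ = 0`. -/
noncomputable def zeroPart (ψ : DimVec r →+ ℝ) (f : MvPowerSeries (Fin r) R) :
    MvPowerSeries (Fin r) R :=
  open Classical in seriesOf fun a => if ψ a = 0 then coeffAt f a else 0

theorem coeffAt_zeroPart (ψ : DimVec r →+ ℝ) (f : MvPowerSeries (Fin r) R) {a : DimVec r}
    (h : ψ a = 0) : coeffAt (zeroPart ψ f) a = coeffAt f a := if_pos h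

theorem coeffAt_zeroPart_of_ne (ψ : DimVec r →+ ℝ) (f : MvPowerSeries (Fin r) R) {a : DimVec r}
    (h : ψ a ≠ 0) : coeffAt (zeroPart ψ f) a = 0 := if_neg h

/-- This lets `zeroPart_mul` be applied to series supported on `ψ ≤ 0`. -/
theorem zeroPart_neg_left (ψ : DimVec r →+ ℝ) (f : MvPowerSeries (Fin r) R) :
    zeroPart (-ψ) f = zeroPart ψ f := by
  refine series_ext fun a => ?_
  by_cases h : ψ a = 0
  · rw [coeffAt_zeroPart ψ f h, coeffAt_zeroPart (-ψ) f (by simpa using h)]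
  · rw [coeffAt_zeroPart_of_ne ψ f h, coeffAt_zeroPart_of_ne (-ψ) f (by simpa using h)]

/-- Two nonnegative values of `ψ` add up to zero only if both are zero, so restriction to this
boundary face is multiplicative. -/
theorem zeroPart_mul (ψ : DimVec r →+ ℝ) {f g : MvPowerSeries (Fin r) R}
    (hf : CoeffsIn (supportFamily R fun a => 0 ≤ ψ a) f)
    (hg : CoeffsIn (supportFamily R fun a => 0 ≤ ψ a) g) :
    zeroPart ψ (f * g) = zeroPart ψ f * zeroPart ψ g := by
  refine series_ext fun a => ?_
  rw [coeffAt_mul]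
  by_cases h : ψ a = 0
  · rw [coeffAt_zeroPart ψ _ h, coeffAt_mul]
    refine Finset.sum_congr rfl fun p hp => ?_
    have hs : ψ p.1 + ψ p.2 = 0 := by rw [← map_add, DimVec.mem_splittings.1 hp, h]
    by_cases h1 : ψ p.1 = 0
    · rw [coeffAt_zeroPart ψ f h1, coeffAt_zeroPart ψ g (by linarith)]
    · rw [coeffAt_zeroPart_of_ne ψ f h1, zero_mul]
      by_cases h2 : 0 ≤ ψ p.1
      · have h3 : ¬ 0 ≤ ψ p.2 := fun h3 => h1 (by linarith)
        rw [mem_supportFamily.1 (hg p.2) h3, mul_zero]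
      · rw [mem_supportFamily.1 (hf p.1) h2, zero_mul]
  · rw [coeffAt_zeroPart_of_ne ψ _ h]
    symm
    refine Finset.sum_eq_zero fun p hp => ?_
    have hs : ψ p.1 + ψ p.2 = ψ a := by rw [← map_add, DimVec.mem_splittings.1 hp]
    by_cases h1 : ψ p.1 = 0
    · have h2 : ψ p.2 ≠ 0 := fun h2 => h (by rw [← hs, h1, h2, add_zero])
      rw [coeffAt_zeroPart_of_ne ψ g h2, mul_zero]
    · rw [coeffAt_zeroPart_of_ne ψ f h1, zero_mul]

theorem zeroPart_eq_one (ψ : DimVec r →+ ℝ) {f : MvPowerSeries (Fin r) R} (h0 : coeffAt f 0 = 1)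
    (hf : ∀ a, a ≠ 0 → ψ a = 0 → coeffAt f a = 0) : zeroPart ψ f = 1 := by
  refine series_ext fun a => ?_
  rw [coeffAt_one]
  split_ifs with ha
  · rw [ha, coeffAt_zeroPart ψ f (map_zero _), h0]
  · by_cases h : ψ a = 0
    · rw [coeffAt_zeroPart ψ f h, hf a ha h]
    · rw [coeffAt_zeroPart_of_ne ψ f h]

theorem CoeffsIn.mono_support {P Q : DimVec r → Prop} (h : ∀ a, P a → Q a)
    {f : MvPowerSeries (Fin r) R} (hf : CoeffsIn (supportFamily R P) f) :
    CoeffsIn (supportFamily R Q) f :=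
  fun a => mem_supportFamily.2 fun hQ => mem_supportFamily.1 (hf a) fun hP => hQ (h a hP)

theorem isGradedFamily_support_nonneg (ψ : DimVec r →+ ℝ) :
    IsGradedFamily (supportFamily R fun a => 0 ≤ ψ a) :=
  isGradedFamily_support (map_zero ψ).ge fun a b ha hb => by
    rw [map_add]; exact add_nonneg ha hb

/-- The generating series of weighted paths equals a geometric series in the factor of equal
slope. -/
theorem pathColl_act_eq_sum (Z : CentralCharge r) (A a : DimVec r → R) (t s : ℚ)
    (ha : (1 - t • augSeries a) * (1 + augSeries A) = 1 - (t - 1) • augSeries a)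
    {γ : DimVec r} (hγ : γ ≠ 0) :
    Coll.act (fun α => pathColl (Z.offset γ) t s α.dropLast) a γ =
      ∑ k ∈ Finset.range γ.deg, s ^ k • coeffAt (augSeries (slopePart Z A γ) ^ (k + 1)) γ := by
  set ψ := Z.offset γ with hψ
  set y := augSeries (slopePart Z A γ) with hy
  set E := augSeries a with hE
  set X := (pathColl ψ t s).series a with hX
  have hV : X * E = (Coll.conv (pathColl ψ t s) (lengthColl r 1)).series a := by
    rw [hE, ← lengthColl_one_series_eq, hX, Coll.series_mul_series]
  have hVn : ∀ n, n ≠ 0 → coeffAt (X * E) n =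
      Coll.act (fun α => pathColl ψ t s α.dropLast) a n := by
    intro n hn
    rw [hV, coeffAt_series]
    refine Coll.act_congr (fun α hα => ?_) fun _ _ => rfl
    rw [Coll.conv_lengthColl_one, if_neg]
    rintro rfl
    exact hn (mem_tuples.1 hα).2.symm
  have hX0 : coeffAt X 0 = 1 := by
    rw [hX, coeffAt_series, Coll.act_zero]; simp [pathColl]
  have hV0 : coeffAt (X * E) 0 = 0 := by rw [coeffAt_mul_zero, hE]; simp
  -- In `X` the final height is weighted as well, while in `X * E` the last step is not. The final
  -- height is `ψ n`, so the two differ by one factor depending only on `n`.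
  have hXn : ∀ n, n ≠ 0 → coeffAt X n = stepWeight t s (ψ n) • coeffAt (X * E) n := by
    intro n hn
    rw [hVn n hn, hX, coeffAt_series, Coll.act, Coll.act, Finset.smul_sum]
    refine Finset.sum_congr rfl fun α hα => ?_
    have hs := (mem_tuples.1 hα).2
    rw [pathColl_eq, hs, mul_smul]
    rintro rfl
    exact hn hs.symm
  -- This explains the weights: for `q = t` the coefficients vanish where `ψ < 0`, and for `q = t -
  -- 1` where `ψ > 0`.
  have hL : ∀ (q : ℚ) n, n ≠ 0 →
      coeffAt (X * (1 - q • E)) n = (stepWeight t s (ψ n) - q) • coeffAt (X * E) n := by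
    intro q n hn
    rw [mul_sub, mul_one, mul_smul_comm, coeffAt_sub, coeffAt_smul, hXn n hn, sub_smul]
  have hL0 : ∀ q : ℚ, coeffAt (X * (1 - q • E)) 0 = 1 := by
    intro q
    rw [mul_sub, mul_one, mul_smul_comm, coeffAt_sub, coeffAt_smul, hX0, hV0, smul_zero, sub_zero]
  have hz : ∀ q : ℚ, zeroPart ψ (X * (1 - q • E)) = 1 + (s + t - q) • zeroPart ψ (X * E) := by
    intro q
    refine series_ext fun n => ?_
    rw [coeffAt_add, coeffAt_smul]
    rcases eq_or_ne n 0 with rfl | hn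
    · rw [coeffAt_zeroPart ψ _ (map_zero ψ), coeffAt_zeroPart ψ _ (map_zero ψ), hL0, hV0]
      simp
    · rw [coeffAt_one, if_neg hn, zero_add]
      by_cases h : ψ n = 0
      · rw [coeffAt_zeroPart ψ _ h, coeffAt_zeroPart ψ _ h, hL q n hn, h]
        simp [stepWeight]
      · rw [coeffAt_zeroPart_of_ne ψ _ h, coeffAt_zeroPart_of_ne ψ _ h, smul_zero]
  obtain ⟨W, hW, -, hW0⟩ := exists_inverse (coeffAt_lowerFactor_zero Z A γ)
  have hWs := (lowerFactor_support Z A hγ).of_mul_eq_one (isGradedFamily_support_neg _)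
    (coeffAt_lowerFactor_zero Z A γ) hW
  have hUs := upperFactor_support Z A hγ
  -- The left side is a product of series supported on `ψ ≥ 0`, the right side one of series
  -- supported on `ψ ≤ 0`, so taking zero parts is multiplicative on both sides.
  have hfac : X * (1 - t • E) * (upperFactor Z A γ * (1 + y)) = X * (1 - (t - 1) • E) * W := by
    rw [← ha, ← slope_factorization Z A hγ]
    simp only [mul_assoc, hW, mul_one, hy]
  have hys : ∀ n, coeffAt y n ≠ 0 → ψ n = 0 := by
    intro n hne
    by_contra h
    rcases eq_or_ne n 0 with rfl | hn
    · exact h (map_zero ψ)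
    · exact hne (by rw [hy, coeffAt_augSeries _ hn, slopePart, if_neg h])
  have h1ys : zeroPart ψ (1 + y) = 1 + y := by
    refine series_ext fun n => ?_
    by_cases h : ψ n = 0
    · rw [coeffAt_zeroPart ψ _ h]
    · rw [coeffAt_zeroPart_of_ne ψ _ h, coeffAt_add, coeffAt_one,
        if_neg (by rintro rfl; exact h (map_zero ψ)), zero_add]
      by_contra hne
      exact h (hys n (Ne.symm hne))
  have sU : CoeffsIn (supportFamily R fun n => 0 ≤ ψ n) (upperFactor Z A γ) :=
    hUs.mono_support fun n hn => by
      rcases hn with rfl | hn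
      · exact (map_zero ψ).ge
      · exact hn.le
  have sy : CoeffsIn (supportFamily R fun n => 0 ≤ ψ n) (1 + y) := fun n =>
    mem_supportFamily.2 fun h => by
      rw [← h1ys, coeffAt_zeroPart_of_ne ψ _ fun h' => h h'.ge]
  have sL : CoeffsIn (supportFamily R fun n => 0 ≤ ψ n) (X * (1 - t • E)) := fun n =>
    mem_supportFamily.2 fun h => by
      have h' : ψ n < 0 := not_le.1 h
      rw [hL t n (by rintro rfl; simp at h), stepWeight, if_neg h'.not_gt, if_pos h', sub_self,
        zero_smul]
  have sL' : CoeffsIn (supportFamily R fun n => 0 ≤ (-ψ) n) (X * (1 - (t - 1) • E)) := fun n =>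
    mem_supportFamily.2 fun h => by
      have h' : 0 < ψ n := by simpa using h
      rw [hL (t - 1) n (by rintro rfl; simp at h), stepWeight, if_pos h', sub_self, zero_smul]
  have sW : CoeffsIn (supportFamily R fun n => 0 ≤ (-ψ) n) W :=
    hWs.mono_support fun n hn => by
      rcases hn with rfl | hn
      · simp
      · simpa using hn.le
  have zU : zeroPart ψ (upperFactor Z A γ) = 1 :=
    zeroPart_eq_one ψ (coeffAt_upperFactor_zero Z A γ) fun n hn h =>
      mem_supportFamily.1 (hUs n) (by simp [hn, ← hψ, h])
  have zW : zeroPart ψ W = 1 :=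
    zeroPart_eq_one ψ hW0 fun n hn h => mem_supportFamily.1 (hWs n) (by simp [hn, ← hψ, h])
  set Y := zeroPart ψ (X * E) with hY
  -- The zero parts of `U` and `W` are `1`, so `hfac` becomes `(1 + s Y)(1 + y) = 1 + (s + 1) Y`.
  have hYeq : Y = (1 + s • Y) * y := by
    have h1 := congrArg (zeroPart ψ) hfac
    rw [zeroPart_mul ψ sL (sU.mul (isGradedFamily_support_nonneg ψ) sy), zeroPart_mul ψ sU sy,
      zU, one_mul, h1ys, hz t, ← zeroPart_neg_left ψ (_ * W), zeroPart_mul (-ψ) sL' sW,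
      zeroPart_neg_left, zeroPart_neg_left, zW, mul_one, hz (t - 1)] at h1
    have e1 : s + t - t = s := by ring
    have e2 : s + t - (t - 1) = s + 1 := by ring
    rw [e1, e2, mul_add, mul_one, add_smul, one_smul, ← add_assoc] at h1
    exact (add_left_cancel h1).symm
  -- Iterating the fixed-point equation gives a geometric series whose remainder contains `y ^ (N +
  -- 1)`; for `N = γ.deg` it vanishes at `γ`.
  have hiter : ∀ N : ℕ, Y = ∑ k ∈ Finset.range N, s ^ k • y ^ (k + 1) +
      s ^ N • ((1 + s • Y) * y ^ (N + 1)) := by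
    intro N
    induction N with
    | zero => simpa using hYeq
    | succ N ih =>
      have h2 : s • (Y * y ^ (N + 1)) = s • ((1 + s • Y) * y ^ (N + 2)) := by
        conv_lhs => rw [hYeq, mul_assoc, ← pow_succ']
      conv_lhs => rw [ih]
      rw [Finset.sum_range_succ, add_mul, one_mul, smul_mul_assoc, h2, smul_add, smul_smul,
        ← pow_succ, add_assoc]
  rw [← hVn γ hγ, ← coeffAt_zeroPart ψ _ (Z.offset_self γ), ← hY, hiter γ.deg, coeffAt_add,
    coeffAt_sum, coeffAt_smul,
    coeffAt_mul_pow_eq_zero (by rw [hy, coeffAt_augSeries_zero]) (Nat.lt_succ_self _), smul_zero,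
    add_zero]
  simp only [coeffAt_smul]

open Polynomial in
/-- An identity between polynomial functions may be integrated from `-1` to `0`. -/
theorem sum_smul_eq_of_forall_eval {V ι κ : Type*} [AddCommGroup V] [Module ℚ V] (t : ℚ)
    (I : Finset ι) (K : Finset κ) (m : ι → ℕ) (n : κ → ℕ) (v : ι → V) (w : κ → V)
    (h : ∀ s : ℚ, ∑ i ∈ I, (s + t) ^ m i • v i = ∑ k ∈ K, s ^ n k • w k) :
    ∑ i ∈ I, ((t ^ (m i + 1) - (t - 1) ^ (m i + 1)) / (m i + 1 : ℚ)) • v i =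
      ∑ k ∈ K, ((-1) ^ n k / (n k + 1 : ℚ)) • w k := by
  -- Linear functionals reduce the claim to scalar polynomials, which can be integrated through
  -- explicit antiderivatives `P` and `Q`.
  rw [← sub_eq_zero, ← Module.forall_dual_apply_eq_zero_iff ℚ]
  intro f
  set p : ℚ[X] := ∑ i ∈ I, C (f (v i)) * (X + C t) ^ m i
  set q : ℚ[X] := ∑ k ∈ K, C (f (w k)) * X ^ n k
  set P : ℚ[X] := ∑ i ∈ I, C (f (v i) / (m i + 1)) * (X + C t) ^ (m i + 1) with hP
  set Q : ℚ[X] := ∑ k ∈ K, C (f (w k) / (n k + 1)) * X ^ (n k + 1) with hQ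
  have hpq : p = q := by
    refine Polynomial.funext fun s => ?_
    have := congrArg f (h s)
    simp only [map_sum, map_smul, smul_eq_mul] at this
    simp only [p, q, eval_finsetSum, eval_mul, eval_C, eval_pow, eval_add, eval_X]
    simpa only [mul_comm (f _)] using this
  have hPd : derivative P = p := by
    simp only [P, p, derivative_sum, derivative_C_mul, derivative_X_add_C_pow]
    refine Finset.sum_congr rfl fun i _ => ?_
    have hne : (m i + 1 : ℚ) ≠ 0 := by positivity
    rw [← mul_assoc, add_tsub_cancel_right, ← C_mul]
    push_cast
    rw [div_mul_cancel₀ _ hne]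
  have hQd : derivative Q = q := by
    simp only [Q, q, derivative_sum, derivative_C_mul, derivative_X_pow]
    refine Finset.sum_congr rfl fun i _ => ?_
    have hne : (n i + 1 : ℚ) ≠ 0 := by positivity
    rw [← mul_assoc, add_tsub_cancel_right, ← C_mul]
    push_cast
    rw [div_mul_cancel₀ _ hne]
  have hd : derivative (P - Q) = 0 := by rw [derivative_sub, hPd, hQd, hpq, sub_self]
  have hc := eq_C_of_derivative_eq_zero hd
  -- `P - Q` is constant. Between `-1` and `0` the shifted variable `s + t` runs from `t - 1` to
  -- `t`.
  have h0 : eval 0 (P - Q) = eval (-1) (P - Q) := by rw [hc]; simp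
  have e1 : f (∑ i ∈ I, ((t ^ (m i + 1) - (t - 1) ^ (m i + 1)) / (m i + 1 : ℚ)) • v i) =
      eval 0 P - eval (-1) P := by
    simp only [hP, eval_finsetSum, map_sum, map_smul, smul_eq_mul, ← Finset.sum_sub_distrib]
    refine Finset.sum_congr rfl fun i _ => ?_
    simp only [eval_mul, eval_C, eval_pow, eval_add, eval_X, zero_add]
    ring
  have e2 : f (∑ k ∈ K, ((-1) ^ n k / (n k + 1 : ℚ)) • w k) = eval 0 Q - eval (-1) Q := by
    simp only [hQ, eval_finsetSum, map_sum, map_smul, smul_eq_mul, ← Finset.sum_sub_distrib]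
    refine Finset.sum_congr rfl fun i _ => ?_
    simp only [eval_mul, eval_C, eval_pow, eval_X]
    ring
  rw [map_sub, e1, e2]
  rw [eval_sub, eval_sub] at h0
  linarith

/-- Comparing an initial part with the remainder, as in `gColl`, thus amounts to comparing it with
the total, as in `pathColl`. -/
theorem CentralCharge.offset_add_left (Z : CentralCharge r) (p q : DimVec r) :
    Z.offset (p + q) p = Z.offset q p := by
  simp only [CentralCharge.offset_apply, Pi.add_apply, Nat.cast_add, mul_add,
    Finset.sum_add_distrib]
  ring

theorem take_drop_of_mem_tuples {γ : DimVec r} {α : List (DimVec r)} (hα : α ∈ tuples γ) {k : ℕ}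
    (hk : k ∈ Finset.Ico 1 α.length) :
    (α.take k).sum + (α.drop k).sum = γ ∧ (α.take k).sum ≠ 0 ∧ (α.drop k).sum ≠ 0 := by
  obtain ⟨h0, hs⟩ := mem_tuples.1 hα
  rw [Finset.mem_Ico] at hk
  refine ⟨by rw [← List.sum_append, List.take_append_drop, hs], fun h => ?_, fun h => ?_⟩
  · have := DimVec.length_le_of_sum_eq (α.take k) fun h' => h0 (List.mem_of_mem_take h')
    rw [h, List.length_take] at this
    simp only [Pi.zero_apply, Finset.sum_const_zero] at this
    omega
  · have := DimVec.length_le_of_sum_eq (α.drop k) fun h' => h0 (List.mem_of_mem_drop h')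
    rw [h, List.length_drop] at this
    simp only [Pi.zero_apply, Finset.sum_const_zero] at this
    omega

theorem cutCount_congr {P Q : DimVec r → DimVec r → Prop} {γ : DimVec r} {α : List (DimVec r)}
    (hα : α ∈ tuples γ)
    (h : ∀ p q, p + q = γ → p ≠ 0 → q ≠ 0 → (P p q ↔ Q p q)) : cutCount P α = cutCount Q α := by
  unfold cutCount
  congr 1
  ext k
  simp only [Finset.mem_filter]
  refine and_congr_right fun hk => ?_
  obtain ⟨h1, h2, h3⟩ := take_drop_of_mem_tuples hα hk
  exact h _ _ h1 h2 h3

theorem gColl_eq (Z : CentralCharge r) (t : ℚ) {γ : DimVec r} {α : List (DimVec r)}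
    (hα : α ∈ tuples γ) : gColl Z t α = geometricValue t
      (cutCount (fun p _ => 0 < Z.offset γ p) α) (cutCount (fun p _ => Z.offset γ p < 0) α)
      (cutCount (fun p _ => Z.offset γ p = 0) α) := by
  unfold gColl
  congr 1
  · refine cutCount_congr hα ?_
    rintro p q rfl hp hq
    rw [Z.offset_add_left, Z.offset_pos_iff hq hp, CentralCharge.Lt]
  · refine cutCount_congr hα ?_
    rintro p q rfl hp hq
    rw [Z.offset_add_left, Z.offset_neg_iff hq hp, CentralCharge.Lt]
  · refine cutCount_congr hα ?_
    rintro p q rfl hp hq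
    rw [Z.offset_add_left, Z.offset_eq_zero_iff hq hp, CentralCharge.Equiv]

/-- The rational invariants are obtained from a series independent of `Z` by acting with
`g_{Z,t}`. -/
theorem rationalDT_eq_gColl_act (Z : CentralCharge r) (A a : DimVec r → R) (t : ℚ)
    (ha : (1 - t • augSeries a) * (1 + augSeries A) = 1 - (t - 1) • augSeries a)
    {γ : DimVec r} (hγ : γ ≠ 0) : rationalDT Z A γ = (gColl Z t).act a γ := by
  classical
  set ψ := Z.offset γ with hψ
  rw [rationalDT_eq_logCoeff Z A hγ, logCoeff, Coll.act]
  have key := sum_smul_eq_of_forall_eval t (tuples γ) (Finset.range γ.deg)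
    (fun α => cutCount (fun p _ => ψ p = 0) α) (fun k => k)
    (fun α => (t ^ cutCount (fun p _ => ψ p < 0) α * (t - 1) ^ cutCount (fun p _ => 0 < ψ p) α) •
      (α.map a).prod)
    (fun k => coeffAt (augSeries (slopePart Z A γ) ^ (k + 1)) γ) (fun s => by
      rw [← pathColl_act_eq_sum Z A a t s ha hγ, Coll.act]
      refine Finset.sum_congr rfl fun α hα => ?_
      rw [pathColl_dropLast, prod_stepWeight, smul_smul]
      · congr 1
        rw [mul_comm]
        simp only [cutCount, hψ]
      · rintro rfl
        exact hγ (mem_tuples.1 hα).2.symm)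
  rw [← key]
  refine Finset.sum_congr rfl fun α hα => ?_
  rw [gColl_eq Z t hα, geometricValue, smul_smul]
  congr 1
  ring

end Deformation

/-! ### Logarithms and traces -/

section Trace

variable {r : ℕ} {R : Type*} [Ring R] [Algebra ℚ R]

/-- The Euler derivation, multiplying the part of degree `a` by the total degree of `a`. -/
noncomputable def eulerDeriv (f : MvPowerSeries (Fin r) R) : MvPowerSeries (Fin r) R :=
  seriesOf fun a => (a.deg : ℚ) • coeffAt f a

@[simp] theorem coeffAt_eulerDeriv (f : MvPowerSeries (Fin r) R) (a : DimVec r) :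
    coeffAt (eulerDeriv f) a = (a.deg : ℚ) • coeffAt f a := rfl

theorem eulerDeriv_mul (f g : MvPowerSeries (Fin r) R) :
    eulerDeriv (f * g) = eulerDeriv f * g + f * eulerDeriv g := by
  refine series_ext fun a => ?_
  simp only [coeffAt_eulerDeriv, coeffAt_add, coeffAt_mul, Finset.smul_sum,
    ← Finset.sum_add_distrib]
  refine Finset.sum_congr rfl fun p hp => ?_
  rw [← DimVec.mem_splittings.1 hp, DimVec.deg_add, smul_mul_assoc, mul_smul_comm, ← add_smul,
    Nat.cast_add]

theorem CoeffsIn.eulerDeriv {C : DimVec r → Submodule ℚ R} {f : MvPowerSeries (Fin r) R}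
    (hf : CoeffsIn C f) : CoeffsIn C (eulerDeriv f) := fun a => (C a).smul_mem _ (hf a)

theorem eulerDeriv_sub_one (f : MvPowerSeries (Fin r) R) :
    eulerDeriv (f - 1) = eulerDeriv f := by
  refine series_ext fun a => ?_
  rw [coeffAt_eulerDeriv, coeffAt_eulerDeriv, coeffAt_sub, coeffAt_one]
  split_ifs with h
  · simp [h, DimVec.deg]
  · rw [sub_zero]

theorem logCoeff_congr {x y : MvPowerSeries (Fin r) R} {γ : DimVec r}
    (h : ∀ a ≤ γ, coeffAt x a = coeffAt y a) : logCoeff x γ = logCoeff y γ := by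
  have key : ∀ n : ℕ, ∀ a ≤ γ, coeffAt (x ^ n) a = coeffAt (y ^ n) a := by
    intro n
    induction n with
    | zero => simp
    | succ n ih =>
      intro a ha
      rw [pow_succ, pow_succ, coeffAt_mul, coeffAt_mul]
      refine Finset.sum_congr rfl fun p hp => ?_
      have hp := DimVec.mem_splittings.1 hp
      rw [ih p.1 ((hp ▸ le_self_add).trans ha), h p.2 ((hp ▸ le_add_self).trans ha)]
  unfold logCoeff
  exact Finset.sum_congr rfl fun k _ => by rw [key _ γ le_rfl]

theorem logCoeff_eq_zero {P : DimVec r → Prop} (hP : IsGradedFamily (supportFamily R P))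
    {x : MvPowerSeries (Fin r) R} (hx : CoeffsIn (supportFamily R P) x) {γ : DimVec r}
    (hγ : ¬ P γ) : logCoeff x γ = 0 :=
  Finset.sum_eq_zero fun k _ => by
    rw [mem_supportFamily.1 (hx.pow hP (k + 1) γ) hγ, smul_zero]

variable {C : DimVec r → Submodule ℚ R} {γ : DimVec r}

/-- By cyclicity the factors `x` can be moved past the derivative, so under the trace a power is
differentiated as if `x` commuted with its derivative. The extra factor `x ^ j` keeps the induction
going. -/
theorem coeffAt_pow_mul_eulerDeriv_pow (hC : IsGradedFamily C)
    (htr : ∀ f g : MvPowerSeries (Fin r) R, CoeffsIn C f → CoeffsIn C g →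
      coeffAt (f * g) γ = coeffAt (g * f) γ)
    {x : MvPowerSeries (Fin r) R} (hx : CoeffsIn C x) (k : ℕ) : ∀ j : ℕ,
    coeffAt (x ^ j * eulerDeriv (x ^ (k + 1))) γ =
      (k + 1 : ℚ) • coeffAt (x ^ (j + k) * eulerDeriv x) γ := by
  induction k with
  | zero => intro j; simp
  | succ k ih =>
    intro j
    have h1 : coeffAt (x ^ j * (eulerDeriv (x ^ (k + 1)) * x)) γ =
        coeffAt (x ^ (j + 1) * eulerDeriv (x ^ (k + 1))) γ := by
      rw [← mul_assoc, htr _ _ ((hx.pow hC j).mul hC (hx.pow hC _).eulerDeriv) hx, ← mul_assoc,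
        ← pow_succ']
    have h2 : j + 1 + k = j + (k + 1) := by ring
    rw [pow_succ x (k + 1), eulerDeriv_mul, mul_add, coeffAt_add, h1, ih (j + 1), h2, ← mul_assoc,
      ← pow_add, Nat.cast_add, Nat.cast_one, add_smul (_ + _), one_smul]

/-- The logarithmic derivative under a trace. -/
theorem deg_smul_logCoeff (hC : IsGradedFamily C)
    (htr : ∀ f g : MvPowerSeries (Fin r) R, CoeffsIn C f → CoeffsIn C g →
      coeffAt (f * g) γ = coeffAt (g * f) γ)
    {u g : MvPowerSeries (Fin r) R} (hu : CoeffsIn C u) (hu0 : coeffAt u 0 = 1)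
    (hg : g * u = 1) (hg' : CoeffsIn C g) :
    (γ.deg : ℚ) • logCoeff (u - 1) γ = coeffAt (g * eulerDeriv u) γ := by
  set x := u - 1 with hx
  have hxC : CoeffsIn C x := hu.sub (CoeffsIn.one hC)
  have hx0 : coeffAt x 0 = 0 := by rw [hx, coeffAt_sub, hu0, coeffAt_one_zero, sub_self]
  -- One term more than in `logCoeff`: it vanishes at `γ`, and the remainder `(-x) ^ N` of the
  -- geometric series for `g` then vanishes there too.
  set N := γ.deg + 1 with hN
  have h1 : logCoeff x γ = ∑ k ∈ Finset.range N,
      ((-1) ^ k / (k + 1 : ℚ)) • coeffAt (x ^ (k + 1)) γ := by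
    have h := coeffAt_mul_pow_eq_zero (f := x) (g := 1) hx0 (Nat.lt_succ_self γ.deg)
    rw [one_mul] at h
    rw [hN, Finset.sum_range_succ, h, smul_zero, add_zero, logCoeff]
  have h2 : (γ.deg : ℚ) • logCoeff x γ =
      ∑ k ∈ Finset.range N, (-1 : ℚ) ^ k • coeffAt (x ^ k * eulerDeriv x) γ := by
    rw [h1, Finset.smul_sum]
    refine Finset.sum_congr rfl fun k _ => ?_
    have h := coeffAt_pow_mul_eulerDeriv_pow hC htr hxC k 0
    rw [pow_zero, one_mul, zero_add, coeffAt_eulerDeriv] at h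
    have hne : (k + 1 : ℚ) ≠ 0 := by positivity
    rw [smul_comm, h, smul_smul, div_mul_cancel₀ _ hne]
  have h3 : g = ∑ k ∈ Finset.range N, (-x) ^ k + g * (-x) ^ N := by
    have h4 := mul_neg_geom_sum (-x) N
    have hu' : u = 1 - -x := by rw [hx]; abel
    calc g = g * ((1 - -x) * ∑ k ∈ Finset.range N, (-x) ^ k) + g * (-x) ^ N := by
          rw [h4]; noncomm_ring
      _ = _ := by rw [← hu', ← mul_assoc, hg, one_mul]
  have h5 : coeffAt (g * (-x) ^ N * eulerDeriv x) γ = 0 := by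
    have hnx : CoeffsIn C (-x) := by
      have := (hxC.sub hxC).sub hxC
      rwa [sub_self, zero_sub] at this
    rw [htr _ _ (hg'.mul hC (hnx.pow hC N)) hxC.eulerDeriv, ← mul_assoc]
    exact coeffAt_mul_pow_eq_zero (by rw [coeffAt_neg, hx0, neg_zero]) (Nat.lt_succ_self _)
  rw [h2, ← eulerDeriv_sub_one u, ← hx]
  conv_rhs => rw [h3, add_mul, coeffAt_add, h5, add_zero, Finset.sum_mul, coeffAt_sum]
  refine Finset.sum_congr rfl fun k _ => ?_
  have : (-x) ^ k = (-1 : ℚ) ^ k • x ^ k := by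
    rw [← smul_pow, neg_smul, one_smul]
  rw [this, smul_mul_assoc, coeffAt_smul]

/-- Under a trace, the logarithm is additive. -/
theorem logCoeff_mul (hC : IsGradedFamily C)
    (htr : ∀ f g : MvPowerSeries (Fin r) R, CoeffsIn C f → CoeffsIn C g →
      coeffAt (f * g) γ = coeffAt (g * f) γ) (hγ : γ ≠ 0)
    {u v : MvPowerSeries (Fin r) R} (hu : CoeffsIn C u) (hu0 : coeffAt u 0 = 1)
    (hv : CoeffsIn C v) (hv0 : coeffAt v 0 = 1) :
    logCoeff (u * v - 1) γ = logCoeff (u - 1) γ + logCoeff (v - 1) γ := by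
  obtain ⟨g, hug, hgu, -⟩ := exists_inverse hu0
  obtain ⟨h, hvh, hhv, -⟩ := exists_inverse hv0
  have hgC := hu.of_mul_eq_one hC hu0 hug
  have hhC := hv.of_mul_eq_one hC hv0 hvh
  have hinv : h * g * (u * v) = 1 := by
    rw [mul_assoc, ← mul_assoc g, hgu, one_mul, hhv]
  have hdeg : (γ.deg : ℚ) ≠ 0 := by exact_mod_cast mt DimVec.deg_eq_zero.1 hγ
  -- After multiplication by the degree, the logarithms become logarithmic derivatives, where the
  -- product rule applies. The inverse of `v` is then moved cyclically to the right to cancel `v`.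
  refine smul_right_injective R hdeg ?_
  simp only [smul_add]
  rw [deg_smul_logCoeff hC htr (hu.mul hC hv) (by rw [coeffAt_mul_zero, hu0, hv0, one_mul]) hinv
      (hhC.mul hC hgC), deg_smul_logCoeff hC htr hu hu0 hgu hgC,
    deg_smul_logCoeff hC htr hv hv0 hhv hhC, eulerDeriv_mul, mul_add, coeffAt_add]
  congr 1
  · rw [mul_assoc, htr _ _ hhC (hgC.mul hC (hu.eulerDeriv.mul hC hv)), mul_assoc, mul_assoc, hvh,
      mul_one]
  · rw [mul_assoc, ← mul_assoc g, hgu, one_mul]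

/-! ### Wall-crossing -/

/-- If `Z'` is close to `Z`, and the coefficient at `γ` is a trace on the series in degrees of the
same `Z`-slope as `γ`, then the rational invariants at `γ` agree. -/
theorem rationalDT_eq_of_close (hC : IsGradedFamily C)
    (htr : ∀ f g : MvPowerSeries (Fin r) R, CoeffsIn C f → CoeffsIn C g →
      coeffAt (f * g) γ = coeffAt (g * f) γ) (hγ : γ ≠ 0) {Z Z' : CentralCharge r}
    {A : DimVec r → R} (hA : ∀ a, a ≠ 0 → slopePart Z A γ a ∈ C a)
    (hpos : ∀ a ≤ γ, 0 < Z.offset γ a → 0 < Z'.offset γ a)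
    (hneg : ∀ a ≤ γ, Z.offset γ a < 0 → Z'.offset γ a < 0) :
    rationalDT Z' A γ = rationalDT Z A γ := by
  set y := slopePart Z A γ with hy
  -- The `Z`-slope part `1 + y` is factored again, now by `Z'`. All factors stay in `C`, where the
  -- trace property is available.
  set u := upperFactor Z' y γ with hu
  set l := lowerFactor Z' y γ with hl
  set w := 1 + augSeries (slopePart Z' y γ) with hw
  have hfac : u * w * l = 1 + augSeries y := slope_factorization Z' y hγ
  have hu0 : coeffAt u 0 = 1 := coeffAt_upperFactor_zero Z' y γ
  have hl0 : coeffAt l 0 = 1 := coeffAt_lowerFactor_zero Z' y γ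
  have hw0 : coeffAt w 0 = 1 := by simp [hw]
  have huC : CoeffsIn C u := coeffsIn_upperFactor hC Z' hA γ
  have hlC : CoeffsIn C l := coeffsIn_lowerFactor hC Z' hA γ
  have hwC : CoeffsIn C w := coeffsIn_one_add_augSeries hC (slopePart_mem hC Z' hA γ)
  have hus := upperFactor_support Z' y hγ
  have hls := lowerFactor_support Z' y hγ
  have hUs := upperFactor_support Z A hγ
  have hLs := lowerFactor_support Z A hγ
  have hself' := Z'.offset_self γ
  -- The logarithms of `u` and `l` vanish at `γ`: they are supported where `Z'.offset γ` is nonzero,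
  -- apart from degree zero, while it is zero at `γ`.
  have glog : logCoeff (augSeries y) γ = logCoeff (w - 1) γ := by
    have e : augSeries y = u * w * l - 1 := by rw [hfac]; abel
    rw [e, logCoeff_mul hC htr hγ (huC.mul hC hwC) (by rw [coeffAt_mul_zero, hu0, hw0, one_mul])
      hlC hl0, logCoeff_mul hC htr hγ huC hu0 hwC hw0,
      logCoeff_eq_zero (isGradedFamily_support_pos (Z'.offset γ))
        (hus.sub (CoeffsIn.one (isGradedFamily_support_pos _))) (by simp [hγ, hself']),
      logCoeff_eq_zero (isGradedFamily_support_neg (Z'.offset γ))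
        (hls.sub (CoeffsIn.one (isGradedFamily_support_neg _))) (by simp [hγ, hself']),
      zero_add, add_zero]
  rw [rationalDT_eq_logCoeff Z A hγ, rationalDT_eq_logCoeff Z' A hγ, ← hy, glog]
  -- The stabilities are compared only in degrees `a ≤ γ`, so the support condition is imposed only
  -- there. It remains closed under addition, as the summands of a vector `≤ γ` are `≤ γ`.
  have gpos : IsGradedFamily (supportFamily R fun a => a ≤ γ → a = 0 ∨ 0 < Z'.offset γ a) :=
    isGradedFamily_support (fun _ => Or.inl rfl) fun a b ha hb hab => by
      rcases ha (le_self_add.trans hab) with rfl | ha' <;>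
        rcases hb (le_add_self.trans hab) with rfl | hb'
      · simp
      · simp [hb']
      · simp [ha']
      · exact Or.inr (by rw [map_add]; exact add_pos ha' hb')
  have gneg : IsGradedFamily (supportFamily R fun a => a ≤ γ → a = 0 ∨ Z'.offset γ a < 0) :=
    isGradedFamily_support (fun _ => Or.inl rfl) fun a b ha hb hab => by
      rcases ha (le_self_add.trans hab) with rfl | ha' <;>
        rcases hb (le_add_self.trans hab) with rfl | hb'
      · simp
      · simp [hb']
      · simp [ha']
      · exact Or.inr (by rw [map_add]; exact add_neg ha' hb')
  have sU : CoeffsIn _ (upperFactor Z A γ * u) :=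
    (hUs.mono_support fun a ha (hle : a ≤ γ) => ha.imp_right (hpos a hle)).mul gpos
      (hus.mono_support fun a ha (_ : a ≤ γ) => ha)
  have sL : CoeffsIn _ (l * lowerFactor Z A γ) :=
    (hls.mono_support fun a ha (_ : a ≤ γ) => ha).mul gneg
      (hLs.mono_support fun a ha (hle : a ≤ γ) => ha.imp_right (hneg a hle))
  have hzero : ∀ (B : DimVec r → R) (a : DimVec r), a ≠ 0 → ¬ Z'.offset γ a = 0 →
      coeffAt (1 + augSeries (slopePart Z' B γ)) a = 0 := fun B a ha h => by
    rw [coeffAt_add, coeffAt_one, if_neg ha, coeffAt_augSeries _ ha, slopePart, if_neg h, zero_add]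
  -- Regrouping `U (u w l) L` as `(U u) w (l L)` gives, up to degree `γ`, a factorization of `1 + A`
  -- of the type belonging to `Z'`, so `w` is its middle factor.
  have huniq := factorization_unique (Z'.offset γ) γ
    (u := upperFactor Z A γ * u) (u₀ := w) (u' := l * lowerFactor Z A γ)
    (v := upperFactor Z' A γ) (v₀ := 1 + augSeries (slopePart Z' A γ))
    (v' := lowerFactor Z' A γ)
    (by
      rw [slope_factorization Z' A hγ, ← slope_factorization Z A hγ, ← hy, ← hfac]
      simp only [mul_assoc])
    (by rw [coeffAt_mul_zero, coeffAt_upperFactor_zero, hu0, one_mul]) hw0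
    (by rw [coeffAt_mul_zero, hl0, coeffAt_lowerFactor_zero, one_mul])
    (coeffAt_upperFactor_zero Z' A γ) (by simp) (coeffAt_lowerFactor_zero Z' A γ)
    (fun a hle ha h => ⟨mem_supportFamily.1 (sU a) (by simp [hle, ha]; exact not_lt.1 h),
      mem_supportFamily.1 (upperFactor_support Z' A hγ a) (by simp [ha]; exact not_lt.1 h)⟩)
    (fun a _ ha h => ⟨hzero y a ha h, hzero A a ha h⟩)
    (fun a hle ha h => ⟨mem_supportFamily.1 (sL a) (by simp [hle, ha]; exact not_lt.1 h),
      mem_supportFamily.1 (lowerFactor_support Z' A hγ a) (by simp [ha]; exact not_lt.1 h)⟩)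
  refine logCoeff_congr fun a ha => ?_
  have h := (huniq a ha).2.1
  rw [coeffAt_sub, sub_eq_zero] at h
  rw [coeffAt_sub, h, coeffAt_add]
  abel

end Trace

/-! ### Attractor invariants -/

section Attractor

variable {r : ℕ} {R : Type*} [Ring R] [Algebra ℚ R]

/-- Each of the countably many non-proportional pairs excludes the zero set of a nonzero linear form
in `θ`, and Baire's theorem applies. -/
theorem dense_isGeneric : Dense {θ : Fin r → ℝ | IsGeneric θ} := by
  let I := {p : DimVec r × DimVec r // ∃ i, p.1 i * ∑ k, p.2 k ≠ p.2 i * ∑ k, p.1 k}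
  let f : I → (Fin r → ℝ) → ℝ := fun p θ =>
    ∑ k, θ k * ((p.1.1 k : ℝ) * (∑ k, p.1.2 k : ℕ) - (p.1.2 k : ℝ) * (∑ k, p.1.1 k : ℕ))
  have hcont : ∀ p, Continuous (f p) := fun p => by fun_prop
  have hopen : ∀ p, IsOpen {θ | f p θ ≠ 0} := fun p => isOpen_ne_fun (hcont p) continuous_const
  have hdense : ∀ p, Dense {θ | f p θ ≠ 0} := by
    intro p
    rw [dense_iff_closure_eq, Set.eq_univ_iff_forall]
    intro θ
    obtain ⟨i, hi⟩ := p.2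
    by_cases h : f p θ = 0
    · have hne : (p.1.1 i : ℝ) * (∑ k, p.1.2 k : ℕ) - (p.1.2 i : ℝ) * (∑ k, p.1.1 k : ℕ) ≠ 0 := by
        rw [sub_ne_zero]
        exact_mod_cast hi
      have hval : ∀ ε : ℝ, f p (θ + ε • Pi.single i 1) = ε *
          ((p.1.1 i : ℝ) * (∑ k, p.1.2 k : ℕ) - (p.1.2 i : ℝ) * (∑ k, p.1.1 k : ℕ)) := by
        intro ε
        have : f p (θ + ε • Pi.single i 1) = f p θ + ε * f p (Pi.single i 1) := by
          simp only [f, Pi.add_apply, Pi.smul_apply, smul_eq_mul, add_mul, Finset.sum_add_distrib,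
            Finset.mul_sum, mul_assoc]
        rw [this, h, zero_add]
        congr 1
        simp only [f]
        rw [Finset.sum_eq_single i]
        · rw [Pi.single_eq_same, one_mul]
        · intro k _ hk
          rw [Pi.single_eq_of_ne hk, zero_mul]
        · intro h'
          exact absurd (Finset.mem_univ i) h'
      have hc : Continuous fun ε : ℝ => θ + ε • (Pi.single i 1 : Fin r → ℝ) := by fun_prop
      have ht : Tendsto (fun ε : ℝ => θ + ε • (Pi.single i 1 : Fin r → ℝ)) (𝓝[≠] 0) (𝓝 θ) := by
        have := (hc.tendsto 0).mono_left (nhdsWithin_le_nhds (s := {0}ᶜ))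
        simpa using this
      refine mem_closure_of_tendsto ht ?_
      filter_upwards [self_mem_nhdsWithin] with ε hε
      rw [hval]
      exact mul_ne_zero hε hne
    · exact subset_closure h
  refine (dense_iInter_of_isOpen hopen hdense).mono ?_
  intro θ hθ a b ha hb hab
  rw [Set.mem_iInter] at hθ
  by_cases hI : ∃ i, a i * ∑ k, b k ≠ b i * ∑ k, a k
  · exfalso
    refine hθ ⟨(a, b), hI⟩ ?_
    have h := ((CentralCharge.ofTheta θ).offset_eq_zero_iff hb ha).2 hab
    rw [CentralCharge.offset_apply] at h
    simp only [CentralCharge.ofTheta, one_mul] at h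
    simp only [f, mul_sub, Finset.sum_sub_distrib, ← mul_assoc, ← Finset.sum_mul]
    push_cast
    exact h
  · push Not at hI
    refine ⟨∑ k, b k, ∑ k, a k, ?_, ?_, ?_⟩
    · exact Nat.one_le_iff_ne_zero.2 (mt DimVec.deg_eq_zero.1 hb)
    · exact Nat.one_le_iff_ne_zero.2 (mt DimVec.deg_eq_zero.1 ha)
    · funext i
      simp only [Pi.smul_apply, smul_eq_mul]
      rw [mul_comm, hI i, mul_comm]

variable (ω : (Fin r → ℤ) →ₗ[ℤ] (Fin r → ℤ) →ₗ[ℤ] ℤ)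

/-- Without this, an eventual equality along the filter would not determine the attractor invariant.
-/
instance genericPerturbations_neBot (γ : DimVec r) : (genericPerturbations ω γ).NeBot :=
  mem_closure_iff_nhdsWithin_neBot.1 (dense_isGeneric _)

theorem DimVec.toInt_add (a b : DimVec r) : (a + b).toInt = a.toInt + b.toInt := by
  funext k; simp [DimVec.toInt]

theorem sum_selfStability_mul (γ a : DimVec r) :
    ∑ k, selfStability ω γ k * a k = (ω a.toInt γ.toInt : ℝ) := by
  have h : a.toInt = ∑ k, (a k : ℤ) • (Pi.single k 1 : Fin r → ℤ) := by
    funext i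
    simp [DimVec.toInt, Finset.sum_apply, Pi.single_apply]
  rw [h]
  simp only [map_sum, map_smul, LinearMap.sum_apply, LinearMap.smul_apply, selfStability]
  push_cast
  refine Finset.sum_congr rfl fun k _ => ?_
  simp [mul_comm]

variable {ω}

theorem skew_self (hskew : ∀ x y : Fin r → ℤ, ω x y = -ω y x) (x : Fin r → ℤ) : ω x x = 0 := by
  have := hskew x x
  omega

theorem offset_selfStability (hskew : ∀ x y : Fin r → ℤ, ω x y = -ω y x) (γ a : DimVec r) :
    (CentralCharge.ofTheta (selfStability ω γ)).offset γ a =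
      (ω a.toInt γ.toInt : ℝ) * ∑ k, (γ k : ℝ) := by
  rw [CentralCharge.offset_apply]
  simp only [CentralCharge.ofTheta, one_mul, sum_selfStability_mul, skew_self hskew]
  simp

theorem sum_pos_of_ne_zero {γ : DimVec r} (hγ : γ ≠ 0) : 0 < ∑ k, (γ k : ℝ) := by
  have := (CentralCharge.ofTheta (0 : Fin r → ℝ)).rho_pos hγ
  simpa [CentralCharge.ofTheta] using this

open Classical in
/-- The homogeneous components of `𝒜` in degrees orthogonal to `γ`, with scalars in degree zero. -/
noncomputable def orthogonalFamily (𝒜 : (Fin r → ℕ) → Submodule ℚ R)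
    (ω : (Fin r → ℤ) →ₗ[ℤ] (Fin r → ℤ) →ₗ[ℤ] ℤ) (γ : DimVec r) : DimVec r → Submodule ℚ R :=
  fun a => if a = 0 then 1 else if ω a.toInt γ.toInt = 0 then 𝒜 a else ⊥

variable (𝒜 : (Fin r → ℕ) → Submodule ℚ R)

theorem isGradedFamily_of_gradedAlgebra [GradedAlgebra 𝒜] : IsGradedFamily (r := r) 𝒜 where
  one_mem := SetLike.GradedOne.one_mem
  mul_mem _ _ _ _ hx hy := SetLike.GradedMul.mul_mem hx hy

theorem isGradedFamily_orthogonalFamily [GradedAlgebra 𝒜] (γ : DimVec r) :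
    IsGradedFamily (orthogonalFamily 𝒜 ω γ) where
  one_mem := by
    rw [orthogonalFamily, if_pos rfl]
    exact Submodule.one_le.1 le_rfl
  mul_mem a b x y hx hy := by
    rcases eq_or_ne a 0 with rfl | ha
    · rw [orthogonalFamily, if_pos rfl, Submodule.mem_one] at hx
      obtain ⟨q, rfl⟩ := hx
      rw [zero_add, ← Algebra.smul_def]
      exact Submodule.smul_mem _ q hy
    rcases eq_or_ne b 0 with rfl | hb
    · rw [orthogonalFamily, if_pos rfl, Submodule.mem_one] at hy
      obtain ⟨q, rfl⟩ := hy
      rw [add_zero, ← Algebra.commutes, ← Algebra.smul_def]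
      exact Submodule.smul_mem _ q hx
    unfold orthogonalFamily at hx hy ⊢
    rw [if_neg ha] at hx
    rw [if_neg hb] at hy
    have hab : a + b ≠ 0 := fun h => ha (add_eq_zero.1 h).1
    rw [if_neg hab]
    split_ifs at hx with h1
    · split_ifs at hy with h2
      · rw [if_pos (by rw [DimVec.toInt_add, map_add, LinearMap.add_apply, h1, h2, add_zero])]
        exact SetLike.GradedMul.mul_mem hx hy
      · rw [(Submodule.mem_bot ℚ).1 hy, mul_zero]
        exact zero_mem _
    · rw [(Submodule.mem_bot ℚ).1 hx, zero_mul]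
      exact zero_mem _

/-- If `a + b = γ` and `⟨a, γ⟩ = 0`, then `⟨a, b⟩ = 0` by skew-symmetry, so the two coefficients
commute. Commutativity is not assumed for degree zero, which is why `orthogonalFamily` has only
scalars there. -/
theorem coeffAt_mul_comm_of_orthogonal (hskew : ∀ x y : Fin r → ℤ, ω x y = -ω y x)
    (hcomm : ∀ γ γ' : DimVec r, γ ≠ 0 → γ' ≠ 0 → ω γ.toInt γ'.toInt = 0 →
      ∀ x ∈ 𝒜 γ, ∀ y ∈ 𝒜 γ', x * y = y * x) (γ : DimVec r)
    {f g : MvPowerSeries (Fin r) R} (hf : CoeffsIn (orthogonalFamily 𝒜 ω γ) f)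
    (hg : CoeffsIn (orthogonalFamily 𝒜 ω γ) g) :
    coeffAt (f * g) γ = coeffAt (g * f) γ := by
  rw [coeffAt_mul, coeffAt_mul]
  refine Finset.sum_nbij' Prod.swap Prod.swap ?_ ?_ (fun _ _ => Prod.swap_swap _)
    (fun _ _ => Prod.swap_swap _) ?_
  · intro p hp
    rw [DimVec.mem_splittings] at hp ⊢
    rw [← hp, add_comm]; rfl
  · intro p hp
    rw [DimVec.mem_splittings] at hp ⊢
    rw [← hp, add_comm]; rfl
  · rintro ⟨a, b⟩ hp
    have hp := DimVec.mem_splittings.1 hp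
    simp only [Prod.swap_prod_mk] at hp ⊢
    have hfa := hf a
    have hgb := hg b
    rcases eq_or_ne a 0 with rfl | ha
    · rw [orthogonalFamily, if_pos rfl, Submodule.mem_one] at hfa
      obtain ⟨q, hq⟩ := hfa
      rw [← hq, Algebra.commutes]
    rcases eq_or_ne b 0 with rfl | hb
    · rw [orthogonalFamily, if_pos rfl, Submodule.mem_one] at hgb
      obtain ⟨q, hq⟩ := hgb
      rw [← hq, Algebra.commutes]
    rw [orthogonalFamily, if_neg ha] at hfa
    rw [orthogonalFamily, if_neg hb] at hgb
    split_ifs at hfa with h1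
    · split_ifs at hgb with h2
      · refine hcomm a b ha hb ?_ _ hfa _ hgb
        rwa [← hp, DimVec.toInt_add, map_add, skew_self hskew, zero_add] at h1
      · rw [(Submodule.mem_bot ℚ).1 hgb, mul_zero, zero_mul]
    · rw [(Submodule.mem_bot ℚ).1 hfa, mul_zero, zero_mul]

theorem continuous_offset_ofTheta (γ a : DimVec r) :
    Continuous fun θ : Fin r → ℝ => (CentralCharge.ofTheta θ).offset γ a := by
  simp only [CentralCharge.offset_apply, CentralCharge.ofTheta]
  fun_prop

/-- Closeness amounts to preserving strict inequalities for the finitely many `a ≤ γ`, an open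
condition. Genericity plays no role: the value is constant on a full neighbourhood, its centre
included. -/
theorem eventually_rationalDT_eq [GradedAlgebra 𝒜] (hskew : ∀ x y : Fin r → ℤ, ω x y = -ω y x)
    (hcomm : ∀ γ γ' : DimVec r, γ ≠ 0 → γ' ≠ 0 → ω γ.toInt γ'.toInt = 0 →
      ∀ x ∈ 𝒜 γ, ∀ y ∈ 𝒜 γ', x * y = y * x)
    {A : DimVec r → R} (hA : ∀ γ : DimVec r, γ ≠ 0 → A γ ∈ 𝒜 γ) {γ : DimVec r} (hγ : γ ≠ 0) :
    ∀ᶠ θ' in 𝓝 (selfStability ω γ), rationalDT (CentralCharge.ofTheta θ') A γ =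
      rationalDT (CentralCharge.ofTheta (selfStability ω γ)) A γ := by
  set Z := CentralCharge.ofTheta (selfStability ω γ) with hZ
  have hev : ∀ᶠ θ' in 𝓝 (selfStability ω γ), ∀ a ∈ Set.Iic γ,
      (0 < Z.offset γ a → 0 < (CentralCharge.ofTheta θ').offset γ a) ∧
      (Z.offset γ a < 0 → (CentralCharge.ofTheta θ').offset γ a < 0) := by
    rw [eventually_all_finite (Set.finite_Iic γ)]
    intro a _
    have hc := (continuous_offset_ofTheta γ a).tendsto (selfStability ω γ)
    rw [← hZ] at hc
    rcases lt_trichotomy (Z.offset γ a) 0 with h | h | h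
    · filter_upwards [hc.eventually_lt_const h] with θ' h'
      exact ⟨fun h'' => absurd h'' h.not_gt, fun _ => h'⟩
    · exact Eventually.of_forall fun θ' => by simp [h]
    · filter_upwards [hc.eventually_const_lt h] with θ' h'
      exact ⟨fun _ => h', fun h'' => absurd h'' h.not_gt⟩
  filter_upwards [hev] with θ' h
  refine rationalDT_eq_of_close (isGradedFamily_orthogonalFamily (ω := ω) 𝒜 γ)
    (fun f g hf hg => coeffAt_mul_comm_of_orthogonal 𝒜 hskew hcomm γ hf hg) hγ (fun a ha => ?_)
    (fun a ha => (h a ha).1) (fun a ha => (h a ha).2)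
  rw [orthogonalFamily, if_neg ha, slopePart, offset_selfStability hskew]
  have hs := (sum_pos_of_ne_zero hγ).ne'
  by_cases h0 : ω a.toInt γ.toInt = 0
  · rw [if_pos h0, if_pos (by simp [h0])]
    exact stackyDT_mem (isGradedFamily_of_gradedAlgebra 𝒜) Z hA a ha
  · rw [if_neg h0, if_neg (mul_ne_zero (by exact_mod_cast h0) hs)]
    exact Submodule.zero_mem _

theorem eventually_rationalDT_eq_attractorDT [GradedAlgebra 𝒜]
    (hskew : ∀ x y : Fin r → ℤ, ω x y = -ω y x)
    (hcomm : ∀ γ γ' : DimVec r, γ ≠ 0 → γ' ≠ 0 → ω γ.toInt γ'.toInt = 0 →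
      ∀ x ∈ 𝒜 γ, ∀ y ∈ 𝒜 γ', x * y = y * x)
    {A : DimVec r → R} (hA : ∀ γ : DimVec r, γ ≠ 0 → A γ ∈ 𝒜 γ) {γ : DimVec r} (hγ : γ ≠ 0) :
    ∀ᶠ θ' in genericPerturbations ω γ,
      rationalDT (CentralCharge.ofTheta θ') A γ = attractorDT ω A γ :=
  Classical.epsilon_spec (p := fun x : R => ∀ᶠ θ' in genericPerturbations ω γ,
      rationalDT (CentralCharge.ofTheta θ') A γ = x)
    ⟨_, (eventually_rationalDT_eq 𝒜 hskew hcomm hA hγ).filter_mono nhdsWithin_le_nhds⟩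

theorem attractorDT_eq [GradedAlgebra 𝒜] (hskew : ∀ x y : Fin r → ℤ, ω x y = -ω y x)
    (hcomm : ∀ γ γ' : DimVec r, γ ≠ 0 → γ' ≠ 0 → ω γ.toInt γ'.toInt = 0 →
      ∀ x ∈ 𝒜 γ, ∀ y ∈ 𝒜 γ', x * y = y * x)
    {A : DimVec r → R} (hA : ∀ γ : DimVec r, γ ≠ 0 → A γ ∈ 𝒜 γ) {γ : DimVec r} (hγ : γ ≠ 0) :
    attractorDT ω A γ = rationalDT (CentralCharge.ofTheta (selfStability ω γ)) A γ := by
  obtain ⟨θ', h1, h2⟩ := ((eventually_rationalDT_eq_attractorDT 𝒜 hskew hcomm hA hγ).and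
    ((eventually_rationalDT_eq 𝒜 hskew hcomm hA hγ).filter_mono nhdsWithin_le_nhds)).exists
  rw [← h1, h2]

/-- For `p + q = γ`, skew-symmetry gives `⟨p, q⟩ = ⟨p, γ⟩`, which is a positive multiple of the
self-stability offset of `p`. -/
theorem gStarColl_eq_gColl (hskew : ∀ x y : Fin r → ℤ, ω x y = -ω y x) (t : ℚ) {γ : DimVec r}
    (hγ : γ ≠ 0) {α : List (DimVec r)} (hα : α ∈ tuples γ) :
    gStarColl ω t α = gColl (CentralCharge.ofTheta (selfStability ω γ)) t α := by
  have hs := sum_pos_of_ne_zero hγ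
  have hpq : ∀ p q : DimVec r, p + q = γ → ω p.toInt γ.toInt = ω p.toInt q.toInt := by
    rintro p q rfl
    rw [DimVec.toInt_add, map_add, skew_self hskew, zero_add]
  rw [gColl_eq _ t hα, gStarColl]
  congr 1
  · refine cutCount_congr hα fun p q h _ _ => ?_
    rw [offset_selfStability hskew, mul_pos_iff_of_pos_right hs, hpq p q h, Int.cast_pos]
  · refine cutCount_congr hα fun p q h _ _ => ?_
    rw [offset_selfStability hskew, hpq p q h, ← Int.cast_lt_zero (R := ℝ)]
    exact ⟨fun h => mul_neg_of_neg_of_pos h hs, fun h => neg_of_mul_neg_left h hs.le⟩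
  · refine cutCount_congr hα fun p q h _ _ => ?_
    rw [offset_selfStability hskew, mul_eq_zero, or_iff_left hs.ne', hpq p q h, Int.cast_eq_zero]

/-- The attractor invariants are obtained by acting with `g_{*,t}`. -/
theorem attractorDT_eq_gStarColl_act [GradedAlgebra 𝒜]
    (hskew : ∀ x y : Fin r → ℤ, ω x y = -ω y x)
    (hcomm : ∀ γ γ' : DimVec r, γ ≠ 0 → γ' ≠ 0 → ω γ.toInt γ'.toInt = 0 →
      ∀ x ∈ 𝒜 γ, ∀ y ∈ 𝒜 γ', x * y = y * x)
    {A a : DimVec r → R} (hA : ∀ γ : DimVec r, γ ≠ 0 → A γ ∈ 𝒜 γ) (t : ℚ)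
    (ha : (1 - t • augSeries a) * (1 + augSeries A) = 1 - (t - 1) • augSeries a)
    {γ : DimVec r} (hγ : γ ≠ 0) : attractorDT ω A γ = (gStarColl ω t).act a γ := by
  rw [attractorDT_eq 𝒜 hskew hcomm hA hγ, rationalDT_eq_gColl_act _ A a t ha hγ]
  exact Coll.act_congr (fun α hα => (gStarColl_eq_gColl hskew t hγ hα).symm) fun _ _ => rfl

end Attractor

/-! ### Sums over forests -/

section Forests

theorem cons_pair_injective (Y : Type*) :
    Function.Injective fun p : Y × List Y => p.1 :: p.2 := fun p q h => by
  simpa [Prod.ext_iff] using h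

/-- The lists obtained by choosing one element of `s x` for each entry `x` of a list. -/
noncomputable def listChoices {X Y : Type*} (s : X → Finset Y) : List X → Finset (List Y)
  | [] => {[]}
  | x :: l => (s x ×ˢ listChoices s l).map ⟨fun p => p.1 :: p.2, cons_pair_injective Y⟩

theorem mem_listChoices {X Y : Type*} {s : X → Finset Y} :
    ∀ {l : List X} {c : List Y}, c ∈ listChoices s l ↔ List.Forall₂ (fun x y => y ∈ s x) l c
  | [], c => by simp [listChoices]
  | x :: l, c => by
    rw [listChoices, Finset.mem_map, List.forall₂_cons_left_iff]
    simp only [Finset.mem_product, Prod.exists]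
    constructor
    · rintro ⟨y, d, ⟨hy, hd⟩, rfl⟩
      exact ⟨y, d, hy, mem_listChoices.1 hd, rfl⟩
    · rintro ⟨y, d, hy, hd, rfl⟩
      exact ⟨y, d, ⟨hy, mem_listChoices.2 hd⟩, rfl⟩

theorem prod_map_sum {X Y R : Type*} [Semiring R] (s : X → Finset Y) (f : Y → R) (l : List X) :
    (l.map fun x => ∑ y ∈ s x, f y).prod = ∑ c ∈ listChoices s l, (c.map f).prod := by
  induction l with
  | nil => simp [listChoices]
  | cons x l ih =>
    rw [List.map_cons, List.prod_cons, ih, listChoices, Finset.sum_map, Finset.sum_mul_sum,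
      Finset.sum_product]
    simp

variable {r : ℕ}

namespace PlaneTree

theorem isReduced_leaf {X : Type*} (x : X) : (leaf x).IsReduced := by
  simp [IsReduced, vertices]

theorem isReduced_node {X : Type*} {c : List (PlaneTree X)} :
    (node c).IsReduced ↔ 2 ≤ c.length ∧ ∀ u ∈ c, u.IsReduced := by
  simp only [IsReduced, vertices, List.mem_cons, List.mem_flatMap]
  constructor
  · intro h
    exact ⟨h c (Or.inl rfl), fun u hu d hd => h d (Or.inr ⟨u, hu, hd⟩)⟩
  · rintro ⟨h1, h2⟩ d (rfl | ⟨u, hu, hd⟩)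
    · exact h1
    · exact h2 u hu d hd

/-- The contribution of a tree to the inverse of the collection `h`. -/
def inverseWeight (h : Coll r) (T : PlaneTree (DimVec r)) : ℚ :=
  (-1) ^ T.vertices.length * (T.vertices.map fun c => h (childTuple c)).prod

theorem prod_inverseWeight (h : Coll r) (c : List (PlaneTree (DimVec r))) :
    (c.map (inverseWeight h)).prod = (-1) ^ (c.flatMap vertices).length *
      ((c.flatMap vertices).map fun d => h (childTuple d)).prod := by
  induction c with
  | nil => simp
  | cons u c ih =>
    rw [List.map_cons, List.prod_cons, ih, inverseWeight, List.flatMap_cons, List.length_append,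
      List.map_append, List.prod_append, pow_add]
    ring

theorem inverseWeight_leaf (h : Coll r) (x : DimVec r) : inverseWeight h (leaf x) = 1 := by
  simp [inverseWeight, vertices]

theorem inverseWeight_node (h : Coll r) (c : List (PlaneTree (DimVec r))) :
    inverseWeight h (node c) = -(h (childTuple c) * (c.map (inverseWeight h)).prod) := by
  rw [prod_inverseWeight, inverseWeight, vertices, List.length_cons, List.map_cons, List.prod_cons,
    pow_succ]
  ring

theorem contribution_node (g h : Coll r) (c : List (PlaneTree (DimVec r))) :
    contribution g h (node c) =
      (g (childTuple c) - h (childTuple c)) * (c.map (inverseWeight h)).prod := by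
  rw [prod_inverseWeight, contribution, vertices, List.length_cons, List.tail_cons,
    Nat.add_sub_cancel]
  ring

/-- The reduced plane trees with nonzero labels of sum `γ`. -/
noncomputable def treesOfSum (γ : DimVec r) : Finset (PlaneTree (DimVec r)) :=
  open Classical in (tuples γ).biUnion reducedOn

theorem mem_treesOfSum {γ : DimVec r} {T : PlaneTree (DimVec r)} :
    T ∈ treesOfSum γ ↔ T.leaves ∈ tuples γ ∧ T.IsReduced := by
  simp only [treesOfSum, Finset.mem_biUnion, mem_reducedOn]
  constructor
  · rintro ⟨α, hα, rfl, h⟩; exact ⟨hα, h⟩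
  · rintro ⟨h1, h2⟩; exact ⟨_, h1, rfl, h2⟩

/-- The lists of reduced plane trees with nonzero labels of sum `γ`. -/
noncomputable def forestsOfSum (γ : DimVec r) : Finset (List (PlaneTree (DimVec r))) :=
  open Classical in (tuples γ).biUnion (listChoices treesOfSum)

theorem sum_ne_zero_of_ne_nil {α : List (DimVec r)} (h0 : (0 : DimVec r) ∉ α) (h : α ≠ []) :
    α.sum ≠ 0 := by
  intro hs
  have := DimVec.length_le_of_sum_eq α h0
  rw [hs] at this
  simp only [Pi.zero_apply, Finset.sum_const_zero, Nat.le_zero, List.length_eq_zero_iff] at this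
  exact h this

theorem sum_flatMap_leaves (c : List (PlaneTree (DimVec r))) :
    (c.flatMap leaves).sum = (childTuple c).sum := by
  induction c with
  | nil => simp [childTuple]
  | cons u c ih =>
    rw [List.flatMap_cons, List.sum_append, ih]
    simp [childTuple]

theorem mem_listChoices_treesOfSum {β : List (DimVec r)} {c : List (PlaneTree (DimVec r))} :
    c ∈ listChoices treesOfSum β ↔
      β = childTuple c ∧ ∀ u ∈ c, (0 : DimVec r) ∉ u.leaves ∧ u.IsReduced := by
  rw [mem_listChoices]
  induction c generalizing β with
  | nil => simp [childTuple]
  | cons u c ih =>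
    rw [List.forall₂_cons_right_iff, List.forall_mem_cons]
    constructor
    · rintro ⟨b, β, hb, hβ, rfl⟩
      obtain ⟨rfl, h3⟩ := ih.1 hβ
      rw [mem_treesOfSum, mem_tuples] at hb
      obtain ⟨⟨h1, rfl⟩, h2⟩ := hb
      exact ⟨rfl, ⟨h1, h2⟩, h3⟩
    · rintro ⟨rfl, ⟨h1, h2⟩, h3⟩
      exact ⟨_, _, mem_treesOfSum.2 ⟨mem_tuples.2 ⟨h1, rfl⟩, h2⟩, ih.2 ⟨rfl, h3⟩, rfl⟩

theorem mem_forestsOfSum {γ : DimVec r} {c : List (PlaneTree (DimVec r))} :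
    c ∈ forestsOfSum γ ↔ c.flatMap leaves ∈ tuples γ ∧ ∀ u ∈ c, u.IsReduced := by
  simp only [forestsOfSum, Finset.mem_biUnion, mem_listChoices_treesOfSum, mem_tuples,
    List.mem_flatMap, sum_flatMap_leaves]
  constructor
  · rintro ⟨β, ⟨h1, h2⟩, rfl, h3⟩
    exact ⟨⟨fun ⟨u, hu, h⟩ => (h3 u hu).1 h, h2⟩, fun u hu => (h3 u hu).2⟩
  · rintro ⟨⟨h1, h2⟩, h3⟩
    refine ⟨_, ⟨?_, h2⟩, rfl, fun u hu => ⟨fun h => h1 ⟨u, hu, h⟩, h3 u hu⟩⟩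
    intro h
    obtain ⟨u, hu, hs⟩ := List.mem_map.1 h
    exact sum_ne_zero_of_ne_nil (fun h' => h1 ⟨u, hu, h'⟩) (leaves_ne_nil u (h3 u hu)) hs

variable {R : Type*} [Ring R] [Algebra ℚ R]

/-- The weighted product of a tree. -/
def treeTerm (h : Coll r) (H : DimVec r → R) (T : PlaneTree (DimVec r)) : R :=
  inverseWeight h T • (T.leaves.map H).prod

theorem prod_treeTerm (h : Coll r) (H : DimVec r → R) (c : List (PlaneTree (DimVec r))) :
    (c.map (treeTerm h H)).prod =
      (c.map (inverseWeight h)).prod • ((c.flatMap leaves).map H).prod := by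
  induction c with
  | nil => simp
  | cons u c ih =>
    rw [List.map_cons, List.prod_cons, ih, treeTerm, List.map_cons, List.prod_cons,
      List.flatMap_cons, List.map_append, List.prod_append, smul_mul_smul_comm]

/-- The action of the inverse of the collection `h`. -/
noncomputable def inverseAct (h : Coll r) (H : DimVec r → R) (γ : DimVec r) : R :=
  ∑ T ∈ treesOfSum γ, treeTerm h H T

/-- Multiplying out the sums over trees attached to the entries of a tuple gives a sum over forests.
The forest determines the tuple as its `childTuple`, so nothing is counted twice. -/
theorem act_inverseAct (f h : Coll r) (H : DimVec r → R) (γ : DimVec r) :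
    f.act (inverseAct h H) γ =
      ∑ c ∈ forestsOfSum γ, f (childTuple c) • (c.map (treeTerm h H)).prod := by
  classical
  rw [forestsOfSum, Finset.sum_biUnion]
  · refine Finset.sum_congr rfl fun β _ => ?_
    unfold inverseAct
    rw [prod_map_sum, Finset.smul_sum]
    refine Finset.sum_congr rfl fun c hc => ?_
    rw [(mem_listChoices_treesOfSum.1 hc).1]
  · intro β _ β' _ hne
    refine Finset.disjoint_left.2 fun c hc hd => hne ?_
    rw [(mem_listChoices_treesOfSum.1 hc).1, (mem_listChoices_treesOfSum.1 hd).1]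

/-- A reduced tree is either a leaf or is obtained by joining a forest of at least two trees. -/
theorem sum_treesOfSum {M : Type*} [AddCommMonoid M] {γ : DimVec r} (hγ : γ ≠ 0)
    (φ : PlaneTree (DimVec r) → M) : ∑ T ∈ treesOfSum γ, φ T =
      φ (leaf γ) + ∑ c ∈ (forestsOfSum γ).filter (fun c => 2 ≤ c.length), φ (node c) := by
  classical
  have h : treesOfSum γ =
      insert (leaf γ) (((forestsOfSum γ).filter fun c => 2 ≤ c.length).image node) := by
    ext T
    simp only [Finset.mem_insert, Finset.mem_image, Finset.mem_filter, mem_treesOfSum,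
      mem_forestsOfSum]
    cases T with
    | leaf x =>
      simp only [leaves, mem_tuples, isReduced_leaf, leaf.injEq, reduceCtorEq, and_false,
        exists_false, or_false, and_true, List.mem_singleton, List.sum_singleton]
      exact ⟨fun h => h.2, by rintro rfl; exact ⟨hγ.symm, rfl⟩⟩
    | node c =>
      simp only [leaves, isReduced_node, reduceCtorEq, false_or, node.injEq, exists_eq_right]
      tauto
  rw [h, Finset.sum_insert, Finset.sum_image]
  · intro c _ d _ hcd
    exact node.inj hcd
  · simp

theorem sum_forestsOfSum {M : Type*} [AddCommMonoid M] {γ : DimVec r} (hγ : γ ≠ 0)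
    (φ : List (PlaneTree (DimVec r)) → M) : ∑ c ∈ forestsOfSum γ, φ c =
      ∑ T ∈ treesOfSum γ, φ [T] +
        ∑ c ∈ (forestsOfSum γ).filter (fun c => 2 ≤ c.length), φ c := by
  classical
  rw [← Finset.sum_filter_add_sum_filter_not (forestsOfSum γ) (fun c => 2 ≤ c.length), add_comm]
  congr 1
  refine Finset.sum_nbij' (fun c => c.headD (leaf γ)) (fun T => [T]) ?_ ?_ ?_ ?_ ?_
  · intro c hc
    rw [Finset.mem_filter, mem_forestsOfSum] at hc
    obtain ⟨⟨h1, h2⟩, h3⟩ := hc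
    match c, h1, h2, h3 with
    | [], h1, _, _ => exact absurd (mem_tuples.1 h1).2.symm hγ
    | [T], h1, h2, _ =>
      exact mem_treesOfSum.2 ⟨by simpa using h1, h2 T (by simp)⟩
    | _ :: _ :: _, _, _, h3 => exact absurd (by simp) h3
  · intro T hT
    rw [mem_treesOfSum] at hT
    rw [Finset.mem_filter, mem_forestsOfSum]
    simpa using hT
  · intro c hc
    rw [Finset.mem_filter, mem_forestsOfSum] at hc
    obtain ⟨⟨h1, h2⟩, h3⟩ := hc
    match c, h1, h3 with
    | [], h1, _ => exact absurd (mem_tuples.1 h1).2.symm hγ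
    | [T], _, _ => rfl
    | _ :: _ :: _, _, h3 => exact absurd (by simp) h3
  · intro T _
    rfl
  · intro c hc
    rw [Finset.mem_filter, mem_forestsOfSum] at hc
    obtain ⟨⟨h1, h2⟩, h3⟩ := hc
    match c, h1, h3 with
    | [], h1, _ => exact absurd (mem_tuples.1 h1).2.symm hγ
    | [T], _, _ => rfl
    | _ :: _ :: _, _, h3 => exact absurd (by simp) h3

theorem act_inverseAct_eq (f h : Coll r) (H : DimVec r → R) {γ : DimVec r} (hγ : γ ≠ 0)
    (hf : f [γ] = 1) : f.act (inverseAct h H) γ = inverseAct h H γ +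
      ∑ c ∈ (forestsOfSum γ).filter (fun c => 2 ≤ c.length),
        f (childTuple c) • (c.map (treeTerm h H)).prod := by
  rw [act_inverseAct, sum_forestsOfSum hγ]
  congr 1
  refine Finset.sum_congr rfl fun T hT => ?_
  have : childTuple [T] = [γ] := by
    simp [childTuple, (mem_tuples.1 (mem_treesOfSum.1 hT).1).2]
  rw [this, hf, one_smul, List.map_singleton, List.prod_singleton]

theorem inverseAct_eq (h : Coll r) (H : DimVec r → R) {γ : DimVec r} (hγ : γ ≠ 0) :
    inverseAct h H γ = H γ - ∑ c ∈ (forestsOfSum γ).filter (fun c => 2 ≤ c.length),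
      h (childTuple c) • (c.map (treeTerm h H)).prod := by
  rw [inverseAct, sum_treesOfSum hγ, sub_eq_add_neg, ← Finset.sum_neg_distrib]
  congr 1
  · rw [treeTerm, inverseWeight_leaf, one_smul, leaves, List.map_singleton, List.prod_singleton]
  · refine Finset.sum_congr rfl fun c _ => ?_
    rw [treeTerm, inverseWeight_node, prod_treeTerm, neg_smul, mul_smul, leaves]

/-- Joining a forest of at least two trees under a new root changes the sign and adds the factor `h`
of that root, so the forest cancels against the resulting tree. -/
theorem act_inverseAct_self (h : Coll r) (H : DimVec r → R) {γ : DimVec r} (hγ : γ ≠ 0)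
    (h1 : h [γ] = 1) : h.act (inverseAct h H) γ = H γ := by
  rw [act_inverseAct_eq h h H hγ h1, inverseAct_eq h H hγ, sub_add_cancel]

end PlaneTree

variable {R : Type*} [Ring R] [Algebra ℚ R]

/-- The action is unitriangular with respect to the degree: longer tuples involve only values in
smaller degree. -/
theorem Coll.act_injective {F : Coll r} (hF : ∀ γ, γ ≠ 0 → F [γ] = 1) {H K : DimVec r → R}
    (h : ∀ γ, γ ≠ 0 → F.act H γ = F.act K γ) : ∀ γ, γ ≠ 0 → H γ = K γ := by
  intro γ
  induction hn : γ.deg using Nat.strong_induction_on generalizing γ with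
  | _ n ih =>
    intro hγ
    have e := h γ hγ
    have hsplit : ∀ L : DimVec r → R, F.act L γ = L γ +
        ∑ α ∈ (tuples γ).filter (fun α => 2 ≤ α.length), F α • (α.map L).prod := by
      intro L
      rw [Coll.act, ← Finset.sum_filter_add_sum_filter_not (tuples γ) (fun α => 2 ≤ α.length),
        tuples_filter_short hγ, Finset.sum_singleton, hF γ hγ, one_smul, List.map_singleton,
        List.prod_singleton, add_comm]
    have hsum : ∑ α ∈ (tuples γ).filter (fun α => 2 ≤ α.length), F α • (α.map H).prod =
        ∑ α ∈ (tuples γ).filter (fun α => 2 ≤ α.length), F α • (α.map K).prod := by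
      refine Finset.sum_congr rfl fun α hα => ?_
      rw [Finset.mem_filter] at hα
      congr 2
      exact List.map_congr_left fun b hb => ih b.deg
        (hn ▸ sum_lt_of_mem_tuples hα.1 hα.2 hb) b rfl fun h0 => (mem_tuples.1 hα.1).1 (h0 ▸ hb)
    rw [hsplit, hsplit, hsum] at e
    exact add_right_cancel e

open PlaneTree

theorem cutCount_singleton (P : DimVec r → DimVec r → Prop) (a : DimVec r) :
    cutCount P [a] = 0 := by
  simp [cutCount]

theorem gColl_singleton (Z : CentralCharge r) (t : ℚ) (a : DimVec r) : gColl Z t [a] = 1 := by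
  simp [gColl, cutCount_singleton, geometricValue]

theorem gStarColl_singleton (ω : (Fin r → ℤ) →ₗ[ℤ] (Fin r → ℤ) →ₗ[ℤ] ℤ) (t : ℚ) (a : DimVec r) :
    gStarColl ω t [a] = 1 := by
  simp [gStarColl, cutCount_singleton, geometricValue]

theorem treeColl_eq_sum (ω : (Fin r → ℤ) →ₗ[ℤ] (Fin r → ℤ) →ₗ[ℤ] ℤ) (Z : CentralCharge r) (t : ℚ)
    {α : List (DimVec r)} (h : α.length ≠ 1) :
    treeColl ω Z t α = ∑ T ∈ reducedOn α, T.contribution (gColl Z t) (gStarColl ω t) := if_neg h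

/-- The tree collection is the quotient of `g_{Z,t}` by `g_{*,t}`. -/
theorem treeColl_act (ω : (Fin r → ℤ) →ₗ[ℤ] (Fin r → ℤ) →ₗ[ℤ] ℤ) (Z : CentralCharge r) (t : ℚ)
    (H : DimVec r → R) {γ : DimVec r} (hγ : γ ≠ 0) :
    (treeColl ω Z t).act H γ = (gColl Z t).act (inverseAct (gStarColl ω t) H) γ := by
  classical
  set g := gColl Z t
  set h := gStarColl ω t
  -- On the tuple `[γ]` the only tree is a leaf, with contribution `0`; the value `1` of `treeColl`
  -- there is split off as the term `H γ`.
  have hcontr : ∀ α ∈ tuples γ, treeColl ω Z t α • (α.map H).prod =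
      (if α = [γ] then H γ else 0) +
        ∑ T ∈ reducedOn α, T.contribution g h • (T.leaves.map H).prod := by
    intro α hα
    have hs : ∑ T ∈ reducedOn α, T.contribution g h • (T.leaves.map H).prod =
        (∑ T ∈ reducedOn α, T.contribution g h) • (α.map H).prod := by
      rw [Finset.sum_smul]
      exact Finset.sum_congr rfl fun T hT => by rw [(mem_reducedOn.1 hT).1]
    rw [hs]
    split_ifs with h1
    · have hzero : ∑ T ∈ reducedOn α, T.contribution g h = 0 := by
        refine Finset.sum_eq_zero fun T hT => ?_
        obtain ⟨hl, hred⟩ := mem_reducedOn.1 hT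
        cases T with
        | leaf x => rfl
        | node c =>
          exfalso
          obtain ⟨hc, hcr⟩ := isReduced_node.1 hred
          match c, hc, hcr, hl with
          | u :: v :: l, _, hcr, hl =>
            have hu := List.length_pos_iff.2 (leaves_ne_nil u (hcr u (by simp)))
            have hv := List.length_pos_iff.2 (leaves_ne_nil v (hcr v (by simp)))
            have := congrArg List.length (hl.trans h1)
            simp only [leaves, List.flatMap_cons, List.length_append, List.length_singleton] at this
            omega
      rw [hzero, zero_smul, add_zero, h1, treeColl, if_pos (by simp), one_smul]
      simp
    · rw [zero_add, treeColl_eq_sum]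
      intro hl
      obtain ⟨b, rfl⟩ := List.length_eq_one_iff.1 hl
      have := (mem_tuples.1 hα).2
      rw [List.sum_singleton] at this
      exact h1 (by rw [this])
  have hmem : [γ] ∈ tuples γ := mem_tuples.2 ⟨by simpa using hγ.symm, by simp⟩
  have hact : (treeColl ω Z t).act H γ = H γ +
      ∑ T ∈ treesOfSum γ, T.contribution g h • (T.leaves.map H).prod := by
    rw [Coll.act, Finset.sum_congr rfl hcontr, Finset.sum_add_distrib, Finset.sum_ite_eq',
      if_pos hmem, treesOfSum, Finset.sum_biUnion]
    intro α _ β _ hne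
    refine Finset.disjoint_left.2 fun T hT hT' => hne ?_
    rw [← (mem_reducedOn.1 hT).1, (mem_reducedOn.1 hT').1]
  -- Both sides are `H γ` plus a sum over forests of at least two trees, the root weighted by `g -
  -- h`: the term `g` comes from the outer action, the term `-h` from the root of an inverse tree.
  rw [hact, sum_treesOfSum hγ, act_inverseAct_eq g h H hγ (gColl_singleton Z t γ),
    inverseAct_eq h H hγ, contribution, zero_smul, zero_add, sub_add, ← sub_neg_eq_add (H γ),
    ← Finset.sum_sub_distrib, ← Finset.sum_neg_distrib]
  congr 1
  refine Finset.sum_congr rfl fun c _ => ?_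
  rw [contribution_node, prod_treeTerm, mul_smul, sub_smul, leaves]
  abel

end Forests

theorem mainTheorem1 {r : ℕ} {R : Type*} [Ring R] [Algebra ℚ R]
    (𝒜 : (Fin r → ℕ) → Submodule ℚ R) [GradedAlgebra 𝒜]
    (ω : (Fin r → ℤ) →ₗ[ℤ] (Fin r → ℤ) →ₗ[ℤ] ℤ)
    (hskew : ∀ x y : Fin r → ℤ, ω x y = -ω y x)
    (hcomm : ∀ γ γ' : DimVec r, γ ≠ 0 → γ' ≠ 0 → ω γ.toInt γ'.toInt = 0 →
      ∀ x ∈ 𝒜 γ, ∀ y ∈ 𝒜 γ', x * y = y * x)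
    (A : DimVec r → R) (hA : ∀ γ : DimVec r, γ ≠ 0 → A γ ∈ 𝒜 γ) :
    (∀ γ : DimVec r, γ ≠ 0 → ∀ᶠ θ' in genericPerturbations ω γ,
      rationalDT (CentralCharge.ofTheta θ') A γ = attractorDT ω A γ) ∧
    ∀ (Z : CentralCharge r) (t : ℚ) (γ : DimVec r), γ ≠ 0 →
      rationalDT Z A γ = (treeColl ω Z t).act (attractorDT ω A) γ := by
  refine ⟨fun γ hγ => eventually_rationalDT_eq_attractorDT 𝒜 hskew hcomm hA hγ,
    fun Z t γ hγ => ?_⟩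
  obtain ⟨a, ha⟩ := exists_deformation A t
  -- Both functions are sent to the attractor invariants by `g_{*,t}`, whose action is injective.
  have hinv : ∀ b, b ≠ 0 → a b = PlaneTree.inverseAct (gStarColl ω t) (attractorDT ω A) b :=
    Coll.act_injective (fun b _ => gStarColl_singleton ω t b) fun b hb => by
      rw [PlaneTree.act_inverseAct_self _ _ hb (gStarColl_singleton ω t b),
        attractorDT_eq_gStarColl_act 𝒜 hskew hcomm hA t ha hb]
  rw [rationalDT_eq_gColl_act Z A a t ha hγ, treeColl_act ω Z t _ hγ]
  exact Coll.act_congr (fun _ _ => rfl) hinv
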